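/- **Setting.** Let $d\ge 1$, $\beta>0$, $M\in\mathbb R$, $\alpha\in(0,1)$, and let $\mathcal V$ be a measurable space. Let $n_1=n_2=n$ and $m_1=m_1(n)$, $m_2=m_2(n)$ be even (the $m_i$ are otherwise arbitrary). For laws $P_{XV},P_{YW}$ on $\mathbb R^d\times\mathcal V$ with marginals $P_X,P_V,P_Y,P_W$, one observes mutually independent samples: labeled data $(X_i,V_i)_{i\le n}$ i.i.d. from $P_{XV}$ and $(Y_i,W_i)_{i\le n}$ i.i.d. from $P_{YW}$; unlabeled data $(V_i)_{n<i\le n+m_1}$ i.i.d. from $P_V$ and $(W_i)_{n<i\le n+m_2}$ i.i.d. from $P_W$; and $\widetilde X_1,\dots,\widetilde X_n$ i.i.d. from $P_X$, $\widetilde Y_1,\dots,\widetilde Y_n$ i.i.d. from $P_Y$. **Test.** Let $k_{s}(x,y)=\exp(-s\|x-y\|^2)$ and $\widehat f(\cdot)=\frac1n\sum_{i}k_{s_n}(\widetilde X_i,\cdot)-\frac1n\sum_i k_{s_n}(\widetilde Y_i,\cdot)$. Regression procedures (measurable, possibly depending on $n$) map $\widehat f$ and $n/2$ labeled points to functions $\widehat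 u_X,\widehat u_Y:\mathcal V\to\mathbb R$, which estimate $v\mapsto\mathbb E[\widehat f(X)\mid V=v,\widehat f]$ and $w\mapsto\mathbb E[\widehat f(Y)\mid W=w,\widehat f]$. For $i\le n+m_1$ let $\widehat e_i$ be the value at $V_i$ of $\widehat u_X$ trained on the labeled points $(X_j,V_j)$ whose index $j\le n$ has parity opposite to that of $i$, and put $r_i=\widehat f(X_i)-\widehat e_i$ for $i\le n$. Put $$\widehat\mu_X^\dagger=\frac1n\sum_{i\le n}r_i+\frac1{n+m_1}\sum_{i\le n+m_1}\widehat e_i,\qquad \widehat\sigma_X^{\dagger2}=\frac{\widehat\sigma_{1,X}^{\dagger2}}{n}+\frac{\widehat\sigma_{2,X}^{\dagger2}}{n+m_1},$$ where $\widehat\sigma_{1,X}^{\dagger2}=\frac1n\sum_{i\le n} r_i^2-(\frac1n\sum_{i\le n} r_i)^2$ and $\widehat\sigma_{2,X}^{\dagger2}=\frac1{n+m_1}\sum_{i\le n+m_1}\widehat e_i^{\,2}-(\frac1{n+m_1}\sum_{i\le n+m_1}\widehat e_i)^2$. Define $\widehat\mu_Y^\dagger,\widehat\sigma_Y^{\dagger2}$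 in the same way from $(Y_i,W_i)$, $\widehat u_Y$ and $m_2$. The xssMMD test is $\Psi_{\mathrm{xss}}=\mathbf 1\{(\widehat\mu_X^\dagger-\widehat\mu_Y^\dagger)/\sqrt{\widehat\sigma_X^{\dagger2}+\widehat\sigma_Y^{\dagger2}}>z_{1-\alpha}\}$, where $z_{1-\alpha}$ is the $(1-\alpha)$-quantile of $N(0,1)$; if the denominator is $0$, the test rejects exactly when the numerator is positive. **Alternatives.** Let $\mathcal W^{\beta,2}(M)$ be the set of integrable, almost everywhere continuous $f:\mathbb R^d\to\mathbb R$ with $\int(1+\|\omega\|^2)^{\beta}|\mathcal F(f)(\omega)|^2\,d\omega<M$, where $\mathcal F(f)(\omega)=\int e^{-2\pi i\langle x,\omega\rangle}f(x)\,dx$. Let $\mathcal P_n^{(1)}$ be the set of pairs $(P_X,P_Y)$ of probability laws on $\mathbb R^d$ with Lebesgue densities $p_X,p_Y\in\mathcal W^{\beta,2}(M)$ and $\|p_X-p_Y\|_{L^2}\ge\Delta_n$. For every even $n$ let $\mathcal Q_n$ be a set of pairs $(P_{XV},P_{YW})$ whose marginals $(P_X,P_Y)$ lie in $\mathcal P^{(1)}_n$.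 **Corollary.** Let $s_n>0$, $s_n\asymp n^{4/(d+4\beta)}$ and $\lim_{n\to\infty}\Delta_n n^{2\beta/(d+4\beta)}=\infty$. Suppose that the residual condition holds: there is a constant $C$ such that for all even $n\ge2$ and all $(P_{XV},P_{YW})\in\mathcal Q_n$, $$\mathbb E\bigl[\{\widehat f(X)-\widehat u_X(V)\}^2\bigr]\le C\,\mathbb E\bigl[\mathrm{Var}\{\widehat f(X)\mid\widehat f\}\bigr],\qquad \mathbb E\bigl[\{\widehat f(Y)-\widehat u_Y(W)\}^2\bigr]\le C\,\mathbb E\bigl[\mathrm{Var}\{\widehat f(Y)\mid\widehat f\}\bigr],$$ where $(X,V)\sim P_{XV}$ and $(Y,W)\sim P_{YW}$ are independent of $\widehat f$ and of the $n/2$ i.i.d. labeled points on which $\widehat u_X$, respectively $\widehat u_Y$, is trained. Then, along even $n$, $$\lim_{n\to\infty}\ \inf_{(P_{XV},P_{YW})\in\mathcal Q_n}\mathbb E[\Psi_{\mathrm{xss}}]=1,$$ where the infimum is taken in $[0,1]$ (it is $1$ if $\mathcal Q_n$ is empty). -/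

import Mathlib

open MeasureTheory ProbabilityTheory Filter Asymptotics
open scoped Topology ENNReal NNReal FourierTransform

namespace XssMMD

/-- The sample space of the primary variables. -/
abbrev Rd (d : ℕ) : Type := EuclideanSpace ℝ (Fin d)

/-! ### Kernel and witness function -/

/-- The Gaussian kernel `k_s(x, y) = exp(-s ‖x - y‖²)`. -/
noncomputable def gaussianKernel {d : ℕ} (s : ℝ) (x y : Rd d) : ℝ :=
  Real.exp (-s * ‖x - y‖ ^ 2)

/-- The estimated witness function
`f̂(x) = n₁⁻¹ ∑ᵢ k(X̃ᵢ, x) - n₂⁻¹ ∑ᵢ k(Ỹᵢ, x)`. -/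
noncomputable def witness {d n₁ n₂ : ℕ} (k : Rd d → Rd d → ℝ)
    (xt : Fin n₁ → Rd d) (yt : Fin n₂ → Rd d) (x : Rd d) : ℝ :=
  (1 / (n₁ : ℝ)) * ∑ i, k (xt i) x - (1 / (n₂ : ℝ)) * ∑ i, k (yt i) x

/-! ### Cross-fitted mean and variance of one (labelled + unlabelled) sample

A labelled sample of even size `n = 2 N` is indexed by `Bool × Fin N`: the first coordinate
tells the fold (`false` for the odd positions, `true` for the even positions of the sample), the
second the place inside the fold. An unlabelled sample of even size `m = 2 h` is indexed by
`Bool × Fin h` in the same way.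

In this section `f` is the function that is averaged and `u S : 𝒱 → ℝ` is the estimate of
`v ↦ E[f(X) | V = v]` that is trained on the `N` labelled points `S`. -/

section CrossFit

variable {d N h : ℕ} {𝒱 : Type*}

/-- The fitted regression used at indices of fold `j`: it is trained on the other fold. -/
def crossFit (u : (Fin N → Rd d × 𝒱) → 𝒱 → ℝ) (L : Bool × Fin N → Rd d × 𝒱) (j : Bool) :
    𝒱 → ℝ :=
  u (fun i => L (!j, i))

/-- `Ê[f(Xᵢ) | Vᵢ]` at a labelled index. -/
def fitLabelled (u : (Fin N → Rd d × 𝒱) → 𝒱 → ℝ) (L : Bool × Fin N → Rd d × 𝒱)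
    (i : Bool × Fin N) : ℝ :=
  crossFit u L i.1 (L i).2

/-- `Ê[f(Xᵢ) | Vᵢ]` at an unlabelled index. -/
def fitUnlabelled (u : (Fin N → Rd d × 𝒱) → 𝒱 → ℝ) (L : Bool × Fin N → Rd d × 𝒱)
    (U : Bool × Fin h → 𝒱) (i : Bool × Fin h) : ℝ :=
  crossFit u L i.1 (U i)

/-- The residual `f(Xᵢ) - Ê[f(Xᵢ) | Vᵢ]` at a labelled index. -/
noncomputable def resid (f : Rd d → ℝ) (u : (Fin N → Rd d × 𝒱) → 𝒱 → ℝ)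
    (L : Bool × Fin N → Rd d × 𝒱) (i : Bool × Fin N) : ℝ :=
  f (L i).1 - fitLabelled u L i

/-- The cross-fitted semi-supervised mean estimator `μ̂†`, with `n = 2 N`, `m = 2 h`. -/
noncomputable def muHat (f : Rd d → ℝ) (u : (Fin N → Rd d × 𝒱) → 𝒱 → ℝ)
    (L : Bool × Fin N → Rd d × 𝒱) (U : Bool × Fin h → 𝒱) : ℝ :=
  (1 / (2 * N : ℝ)) * ∑ i, resid f u L i
    + (1 / (2 * N + 2 * h : ℝ)) * (∑ i, fitLabelled u L i + ∑ i, fitUnlabelled u L U i)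

/-- The empirical variance `σ̂₁†²` of the `n` residuals. -/
noncomputable def sigmaSqOne (f : Rd d → ℝ) (u : (Fin N → Rd d × 𝒱) → 𝒱 → ℝ)
    (L : Bool × Fin N → Rd d × 𝒱) : ℝ :=
  (1 / (2 * N : ℝ)) * ∑ i, resid f u L i ^ 2 - ((1 / (2 * N : ℝ)) * ∑ i, resid f u L i) ^ 2

/-- The empirical variance `σ̂₂†²` of the `n + m` fitted values. -/
noncomputable def sigmaSqTwo (u : (Fin N → Rd d × 𝒱) → 𝒱 → ℝ)
    (L : Bool × Fin N → Rd d × 𝒱) (U : Bool × Fin h → 𝒱) : ℝ :=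
  (1 / (2 * N + 2 * h : ℝ)) *
      (∑ i, fitLabelled u L i ^ 2 + ∑ i, fitUnlabelled u L U i ^ 2)
    - ((1 / (2 * N + 2 * h : ℝ)) *
      (∑ i, fitLabelled u L i + ∑ i, fitUnlabelled u L U i)) ^ 2

/-- The cross-fitted variance estimator `σ̂†² = n⁻¹ σ̂₁†² + (n + m)⁻¹ σ̂₂†²`. -/
noncomputable def sigmaSq (f : Rd d → ℝ) (u : (Fin N → Rd d × 𝒱) → 𝒱 → ℝ)
    (L : Bool × Fin N → Rd d × 𝒱) (U : Bool × Fin h → 𝒱) : ℝ :=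
  (1 / (2 * N : ℝ)) * sigmaSqOne f u L + (1 / (2 * N + 2 * h : ℝ)) * sigmaSqTwo u L U

end CrossFit

/-! ### The test -/

/-- The studentized ratio `a / √v`, read as `+∞` (for `a > 0`) or `-∞` (for `a ≤ 0`) when the
variance estimate `v` vanishes. -/
noncomputable def studentize (a v : ℝ) : EReal :=
  if 0 < v then ((a / √v : ℝ) : EReal) else if 0 < a then ⊤ else ⊥

/-- The `q`-quantile of the standard normal distribution. -/
noncomputable def normalQuantile (q : ℝ) : ℝ :=
  sInf {x : ℝ | q ≤ cdf (gaussianReal 0 1) x}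

/-- A conditional mean estimator: from a function `f`, `N` labelled points and a covariate value
it computes an estimate of the conditional mean of `f` of the primary variable. -/
abbrev Regressor (d N : ℕ) (𝒱 : Type*) : Type _ :=
  (Rd d → ℝ) → (Fin N → Rd d × 𝒱) → 𝒱 → ℝ

/-- All the data, for `n₁ = n₂ = 2 N`, `m₁ = 2 h₁`, `m₂ = 2 h₂`: the points `X̃` and `Ỹ` on which
the witness function is built, the labelled and unlabelled first sample, and the labelled and
unlabelled second sample. -/
abbrev Data (d N h₁ h₂ : ℕ) (𝒱 : Type*) : Type _ :=
  ((Fin (2 * N) → Rd d) × (Fin (2 * N) → Rd d)) ×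
    ((Bool × Fin N → Rd d × 𝒱) × (Bool × Fin h₁ → 𝒱)) ×
    ((Bool × Fin N → Rd d × 𝒱) × (Bool × Fin h₂ → 𝒱))

/-- The law of `(X̃, Ỹ)`: independent i.i.d. samples of size `2 N` from the `X`-marginal of `PXV`
and from the `Y`-marginal of `PYW`. -/
noncomputable def witnessLaw {d : ℕ} {𝒱 : Type*} [MeasurableSpace 𝒱] (N : ℕ)
    (PXV PYW : Measure (Rd d × 𝒱)) : Measure ((Fin (2 * N) → Rd d) × (Fin (2 * N) → Rd d)) :=
  (Measure.pi fun _ => PXV.fst).prod (Measure.pi fun _ => PYW.fst)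

/-- The joint law of all the data: all points are independent, labelled points follow `PXV` or
`PYW`, and unlabelled points the marginal law of `V` or `W`. -/
noncomputable def dataLaw {d : ℕ} {𝒱 : Type*} [MeasurableSpace 𝒱] (N h₁ h₂ : ℕ)
    (PXV PYW : Measure (Rd d × 𝒱)) : Measure (Data d N h₁ h₂ 𝒱) :=
  (witnessLaw N PXV PYW).prod
    (((Measure.pi fun _ => PXV).prod (Measure.pi fun _ => PXV.snd)).prod
      ((Measure.pi fun _ => PYW).prod (Measure.pi fun _ => PYW.snd)))

section Test

variable {d N h₁ h₂ : ℕ} {𝒱 : Type*}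

/-- The xssMMD statistic
`(μ̂†_{X,f̂} - μ̂†_{Y,f̂}) / √(σ̂†²_{X,f̂} + σ̂†²_{Y,f̂})` with kernel `k`. -/
noncomputable def xssStatistic (k : Rd d → Rd d → ℝ) (uX uY : Regressor d N 𝒱)
    (D : Data d N h₁ h₂ 𝒱) : EReal :=
  let f := witness k D.1.1 D.1.2
  studentize (muHat f (uX f) D.2.1.1 D.2.1.2 - muHat f (uY f) D.2.2.1 D.2.2.2)
    (sigmaSq f (uX f) D.2.1.1 D.2.1.2 + sigmaSq f (uY f) D.2.2.1 D.2.2.2)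

/-- The expectation `E[Ψ_xss]` of the test `Ψ_xss = 1(statistic > z_{1-α})`. -/
noncomputable def xssPower [MeasurableSpace 𝒱] (h₁ h₂ : ℕ) (α : ℝ) (k : Rd d → Rd d → ℝ)
    (uX uY : Regressor d N 𝒱) (PXV PYW : Measure (Rd d × 𝒱)) : ℝ :=
  (dataLaw N h₁ h₂ PXV PYW).real
    {D | (normalQuantile (1 - α) : EReal) < xssStatistic k uX uY D}

/-- The infimum of the power over a class `𝒬` of pairs of joint laws, taken in `[0, 1]` (so that
it is `1` for the empty class). -/
noncomputable def worstCasePower [MeasurableSpace 𝒱] (h₁ h₂ : ℕ) (α : ℝ)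
    (k : Rd d → Rd d → ℝ) (uX uY : Regressor d N 𝒱)
    (𝒬 : Set (ProbabilityMeasure (Rd d × 𝒱) × ProbabilityMeasure (Rd d × 𝒱))) : ℝ :=
  sInf (insert 1 ((fun q => xssPower h₁ h₂ α k uX uY (q.1 : Measure (Rd d × 𝒱)) q.2) '' 𝒬))

/-! ### The residual condition -/

/-- Joint measurability of the fitted values in `X̃`, `Ỹ`, the training points and the covariate,
for the witness function of kernel `k`. -/
def MeasurableRegressor [MeasurableSpace 𝒱] (k : Rd d → Rd d → ℝ) (u : Regressor d N 𝒱) : Prop :=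
  Measurable fun z : ((Fin (2 * N) → Rd d) × (Fin (2 * N) → Rd d)) ×
      (Fin N → Rd d × 𝒱) × 𝒱 =>
    u (witness k z.1.1 z.1.2) z.2.1 z.2.2

/-- `E[{f̂(Z) - û(T)}²]`, where `w = (X̃, Ỹ)` has law `ν`, `û` is trained on `N` i.i.d. points from
`ρ`, and `(Z, T)` is a fresh point from `ρ`. -/
noncomputable def residualSecondMoment [MeasurableSpace 𝒱] (k : Rd d → Rd d → ℝ)
    (u : Regressor d N 𝒱) (ν : Measure ((Fin (2 * N) → Rd d) × (Fin (2 * N) → Rd d)))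
    (ρ : Measure (Rd d × 𝒱)) : ℝ≥0∞ :=
  ∫⁻ w, (∫⁻ S, (∫⁻ z,
      ENNReal.ofReal ((witness k w.1 w.2 z.1 - u (witness k w.1 w.2) S z.2) ^ 2) ∂ρ)
    ∂(Measure.pi fun _ : Fin N => ρ)) ∂ν

/-- `E[Var{f̂(Z) | f̂}]`, where `w = (X̃, Ỹ)` has law `ν` and `Z` is an independent point with the
first marginal of `ρ` as its law. -/
noncomputable def expectedCondVariance [MeasurableSpace 𝒱] (k : Rd d → Rd d → ℝ)
    (ν : Measure ((Fin (2 * N) → Rd d) × (Fin (2 * N) → Rd d)))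
    (ρ : Measure (Rd d × 𝒱)) : ℝ≥0∞ :=
  ∫⁻ w, evariance (witness k w.1 w.2) ρ.fst ∂ν

/-- The residual condition with constant `C`, for both samples:
`E[{f̂(X) - û_X(V)}²] ≤ C E[Var{f̂(X) | f̂}]` and `E[{f̂(Y) - û_Y(W)}²] ≤ C E[Var{f̂(Y) | f̂}]`. -/
def ResidualCondition [MeasurableSpace 𝒱] (k : Rd d → Rd d → ℝ) (uX uY : Regressor d N 𝒱)
    (C : ℝ≥0) (PXV PYW : Measure (Rd d × 𝒱)) : Prop :=
  residualSecondMoment k uX (witnessLaw N PXV PYW) PXV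
      ≤ C * expectedCondVariance k (witnessLaw N PXV PYW) PXV ∧
    residualSecondMoment k uY (witnessLaw N PXV PYW) PYW
      ≤ C * expectedCondVariance k (witnessLaw N PXV PYW) PYW

end Test

/-! ### Smooth local alternatives -/

/-- The Sobolev ball `W^{β,2}(M)` among integrable functions on `ℝᵈ`: almost everywhere continuous
`f` with `∫ (1 + ‖ω‖²)^β |𝓕 f(ω)|² dω < M`. -/
def sobolevBall (d : ℕ) (β M : ℝ) : Set (Rd d → ℝ) :=
  {f | Integrable f volume ∧ (∀ᵐ x ∂(volume : Measure (Rd d)), ContinuousAt f x) ∧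
    ∫⁻ ω : Rd d, ENNReal.ofReal
      ((1 + ‖ω‖ ^ 2) ^ β * ‖𝓕 (fun x : Rd d => (f x : ℂ)) ω‖ ^ 2) < ENNReal.ofReal M}

/-- Pairs of laws on `ℝᵈ` with Lebesgue densities in `W^{β,2}(M)` at `L²`-distance at least `δ`. -/
def smoothAlternatives (d : ℕ) (β M δ : ℝ) : Set (Measure (Rd d) × Measure (Rd d)) :=
  {P | ∃ p ∈ sobolevBall d β M, ∃ q ∈ sobolevBall d β M,
    (∀ x, 0 ≤ p x) ∧ (∀ x, 0 ≤ q x) ∧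
    P.1 = volume.withDensity (fun x => ENNReal.ofReal (p x)) ∧
    P.2 = volume.withDensity (fun x => ENNReal.ofReal (q x)) ∧
    ENNReal.ofReal δ ≤ eLpNorm (p - q) 2 volume}

end XssMMD

/-!
Work conditionally on `f̂` and write `a` for its mean, the difference of the kernel mean
embeddings, so that the signal `γ = E a(X) - E a(Y)` is the squared maximum mean discrepancy. Let
`R` be the mean squared residual and `V` the expected conditional variance of `f̂`. Because of the
cross-fitting (opposite parities), conditionally on `f̂` and on one half of the labelled sample
each fold of `μ̂†` is a control-variate estimator with independent summands; hence
`E (μ̂† - E[f̂(X) | f̂])²` and `E σ̂†²` are `O((R + V) / n)`, where `R ≤ C V` by the residual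
condition. A failed test forces `γ² ≤ 2 z² σ̂² + 2 (μ̂_X† - μ̂_Y† - γ)²`, so a single application
of Markov's inequality bounds the type II error by a multiple of `V / (n γ²)`.

Put `c = (π / s) ^ (d / 2)`, the mass of the kernel, and `D = ‖p - q‖₂`. The Cauchy–Schwarz
inequality and the `L²` bounds for Gaussian smoothing give `V ≲ √c c √M D² + c M / n`. On the
Fourier side `γ = c ∫ exp (-π² ‖ω‖² / s) |𝓕(p - q)|²`, which is at least
`c exp (-π²) (D² - 4 M s ^ (-β))`: frequencies with `‖ω‖² ≤ s` lose at most the factor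
`exp (-π²)`, the others carry at most `4 M s ^ (-β)` of `D²`. With `s ≍ n ^ (4 / (d + 4β))` both
`s ^ (-β)` and `√M / (n √c)` are of order `n ^ (-4β / (d + 4β)) = o(Δ²)`, so the bias is
negligible and the relative noise `√M / (n √c D²)` tends to zero.
-/

namespace XssMMD

section SecondMoment

variable {Ω Ω' ι : Type*} [MeasurableSpace Ω] [MeasurableSpace Ω'] {μ : Measure Ω}
  {ν : Measure Ω'} {g : Ω → ℝ}

/-- The second moment `E[g²]` of a real random variable, as an extended nonnegative number so that
it is meaningful without any integrability. -/
noncomputable def secondMoment (g : Ω → ℝ) (μ : Measure Ω) : ℝ≥0∞ :=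
  ∫⁻ x, ENNReal.ofReal (g x ^ 2) ∂μ

lemma evariance_eq_secondMoment (g : Ω → ℝ) (μ : Measure Ω) :
    evariance g μ = secondMoment (fun x => g x - ∫ y, g y ∂μ) μ :=
  evariance_eq_lintegral_ofReal g μ

lemma secondMoment_const_mul (a : ℝ) (g : Ω → ℝ) (μ : Measure Ω) :
    secondMoment (fun x => a * g x) μ = ENNReal.ofReal (a ^ 2) * secondMoment g μ := by
  simp only [secondMoment, mul_pow, ENNReal.ofReal_mul (sq_nonneg a)]
  exact lintegral_const_mul' _ _ ENNReal.ofReal_ne_top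

lemma ofReal_add_sq_le (a b : ℝ) :
    ENNReal.ofReal ((a + b) ^ 2) ≤ 2 * ENNReal.ofReal (a ^ 2) + 2 * ENNReal.ofReal (b ^ 2) := by
  rw [← mul_add, ← ENNReal.ofReal_add (sq_nonneg a) (sq_nonneg b), ← ENNReal.ofReal_ofNat 2,
    ← ENNReal.ofReal_mul zero_le_two]
  exact ENNReal.ofReal_le_ofReal add_sq_le

lemma secondMoment_add_le {f : Ω → ℝ} (hf : AEMeasurable f μ) (g : Ω → ℝ) :
    secondMoment (fun x => f x + g x) μ ≤ 2 * secondMoment f μ + 2 * secondMoment g μ := by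
  simp only [secondMoment]
  rw [← lintegral_const_mul' _ _ ENNReal.ofNat_ne_top,
    ← lintegral_const_mul' _ _ ENNReal.ofNat_ne_top, ← lintegral_add_left' (by fun_prop)]
  exact lintegral_mono fun x => ofReal_add_sq_le (f x) (g x)

lemma secondMoment_sub_le {f : Ω → ℝ} (hf : AEMeasurable f μ) (g : Ω → ℝ) :
    secondMoment (fun x => f x - g x) μ ≤ 2 * secondMoment f μ + 2 * secondMoment g μ := by
  simpa only [sub_eq_add_neg, secondMoment, neg_sq] using secondMoment_add_le hf (fun x => -g x)

lemma secondMoment_comp {φ : Ω' → Ω} (hφ : MeasurePreserving φ ν μ) (hg : Measurable g) :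
    secondMoment (fun x => g (φ x)) ν = secondMoment g μ :=
  hφ.lintegral_comp (f := fun x => ENNReal.ofReal (g x ^ 2)) (by fun_prop)

lemma secondMoment_prod [SFinite ν] {G : Ω × Ω' → ℝ} (hG : Measurable G) :
    secondMoment G (μ.prod ν) = ∫⁻ x, secondMoment (fun y => G (x, y)) ν ∂μ :=
  lintegral_prod _ (by fun_prop)

lemma lintegral_ofReal_sum_sq_le [Fintype ι] {g : ι → Ω → ℝ} (hg : ∀ i, Measurable (g i))
    {K : ℝ≥0∞} (hK : ∀ i, secondMoment (g i) μ ≤ K) :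
    ∫⁻ x, ENNReal.ofReal (∑ i, g i x ^ 2) ∂μ ≤ Fintype.card ι * K := by
  simp only [ENNReal.ofReal_sum_of_nonneg fun _ _ => sq_nonneg _]
  rw [lintegral_finsetSum _ fun i _ => by fun_prop, ← nsmul_eq_mul]
  exact Finset.sum_le_card_nsmul _ _ _ fun i _ => hK i

lemma memLp_two_of_secondMoment_ne_top (hg : AEStronglyMeasurable g μ)
    (h : secondMoment g μ ≠ ∞) : MemLp g 2 μ := by
  rw [memLp_two_iff_integrable_sq hg]
  refine ⟨hg.pow 2, ?_⟩
  rw [hasFiniteIntegral_iff_ofReal (ae_of_all _ fun _ => sq_nonneg _)]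
  exact h.lt_top

lemma memLp_two_of_secondMoment_sub_ne_top [IsFiniteMeasure μ] (hg : AEStronglyMeasurable g μ)
    {c : ℝ} (h : secondMoment (fun x => g x - c) μ ≠ ∞) : MemLp g 2 μ := by
  simpa using (memLp_two_of_secondMoment_ne_top (hg.sub aestronglyMeasurable_const) h).add
    (memLp_const c)

lemma evariance_le_secondMoment_sub [IsProbabilityMeasure μ] (hg : AEStronglyMeasurable g μ)
    (c : ℝ) : evariance g μ ≤ secondMoment (fun x => g x - c) μ := by
  by_cases htop : secondMoment (fun x => g x - c) μ = ∞
  · exact htop ▸ le_top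
  have hgL2 : MemLp g 2 μ := memLp_two_of_secondMoment_sub_ne_top hg htop
  have hgcL2 : MemLp (fun x => g x - c) 2 μ := hgL2.sub (memLp_const c)
  rw [secondMoment, ← ofReal_variance hgL2, ← variance_sub_const hg c,
    ← ofReal_integral_eq_lintegral_ofReal hgcL2.integrable_sq (ae_of_all _ fun _ => sq_nonneg _)]
  exact ENNReal.ofReal_le_ofReal (variance_le_expectation_sq hgcL2.aestronglyMeasurable)

variable [Fintype ι] [IsProbabilityMeasure μ]

lemma secondMoment_sum_sub_integral (hg : MemLp g 2 μ) :
    secondMoment (fun x : ι → Ω => ∑ i, (g (x i) - ∫ y, g y ∂μ)) (Measure.pi fun _ => μ)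
      = Fintype.card ι * evariance g μ := by
  have hcoord (i : ι) : MemLp (fun x : ι → Ω => g (x i)) 2 (Measure.pi fun _ => μ) :=
    hg.comp_measurePreserving (measurePreserving_eval (fun _ => μ) i)
  have hsum : MemLp (∑ i : ι, fun x : ι → Ω => g (x i)) 2 (Measure.pi fun _ => μ) :=
    memLp_finsetSum' _ fun i _ => hcoord i
  have hmean : ∫ x, (∑ i : ι, fun x : ι → Ω => g (x i)) x ∂(Measure.pi fun _ => μ)
      = ∑ _i : ι, ∫ y, g y ∂μ := by
    simp only [Finset.sum_apply]
    rw [integral_finsetSum _ fun i _ => (hcoord i).integrable one_le_two]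
    exact Finset.sum_congr rfl fun i _ =>
      integral_comp_eval (μ := fun _ : ι => μ) hg.aestronglyMeasurable
  calc _ = evariance (∑ i : ι, fun x : ι → Ω => g (x i)) (Measure.pi fun _ => μ) := by
        rw [evariance_eq_secondMoment, hmean]
        simp only [Finset.sum_apply, Finset.sum_sub_distrib]
    _ = ENNReal.ofReal (∑ _i : ι, variance g μ) := by
        rw [← ofReal_variance hsum, variance_sum_pi fun _ => hg]
    _ = Fintype.card ι * evariance g μ := by
        rw [Finset.sum_const, nsmul_eq_mul, ENNReal.ofReal_mul (by positivity),
          ofReal_variance hg, ENNReal.ofReal_natCast, Finset.card_univ]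

lemma secondMoment_sum_sub_integral_le (hg : AEStronglyMeasurable g μ) (c : ℝ) :
    secondMoment (fun x : ι → Ω => ∑ i, (g (x i) - ∫ y, g y ∂μ)) (Measure.pi fun _ => μ)
      ≤ Fintype.card ι * secondMoment (fun x => g x - c) μ := by
  rcases isEmpty_or_nonempty ι
  · simp [secondMoment]
  by_cases htop : secondMoment (fun x => g x - c) μ = ∞
  · rw [htop, ENNReal.mul_top (by simp)]
    exact le_top
  · rw [secondMoment_sum_sub_integral (memLp_two_of_secondMoment_sub_ne_top hg htop)]
    gcongr
    exact evariance_le_secondMoment_sub hg c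

end SecondMoment

section Folds

variable {E ι : Type*} [MeasurableSpace E] [Fintype ι] (ρ : Measure E) [IsProbabilityMeasure ρ]

lemma measurePreserving_folds (j : Bool) :
    MeasurePreserving (fun L : Bool × ι → E => ((fun i => L (!j, i)), fun i => L (j, i)))
      (Measure.pi fun _ => ρ) ((Measure.pi fun _ => ρ).prod (Measure.pi fun _ => ρ)) := by
  have hsum := measurePreserving_sumPiEquivProdPi fun _ : ι ⊕ ι => ρ
  have hreindex (e : Bool × ι ≃ ι ⊕ ι) := measurePreserving_piCongrLeft (fun _ : ι ⊕ ι => ρ) e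
  cases j
  · exact hsum.comp (hreindex ((Equiv.boolProdEquivSum ι).trans (Equiv.sumComm ι ι)))
  · exact hsum.comp (hreindex (Equiv.boolProdEquivSum ι))

lemma measurePreserving_fold (j : Bool) :
    MeasurePreserving (fun (L : Bool × ι → E) i => L (j, i)) (Measure.pi fun _ => ρ)
      (Measure.pi fun _ => ρ) :=
  MeasurePreserving.comp (measurePreserving_snd (μ := Measure.pi fun _ : ι => ρ))
    (measurePreserving_folds ρ j)

end Folds

section CrossFitBounds

variable {d N h : ℕ} {𝒱 : Type*}

/-- The contribution of one fold to the cross-fitted mean estimator `μ̂†`, when the regression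
function `e` comes from the other fold. -/
noncomputable def foldEstimate (f : Rd d → ℝ) (e : 𝒱 → ℝ) (T : Fin N → Rd d × 𝒱)
    (U : Fin h → 𝒱) : ℝ :=
  (1 / (2 * N : ℝ)) * ∑ i, (f (T i).1 - e (T i).2)
    + (1 / (2 * N + 2 * h : ℝ)) * (∑ i, e (T i).2 + ∑ i, e (U i))

lemma muHat_eq_foldEstimate_add (f : Rd d → ℝ) (u : (Fin N → Rd d × 𝒱) → 𝒱 → ℝ)
    (L : Bool × Fin N → Rd d × 𝒱) (U : Bool × Fin h → 𝒱) :
    muHat f u L U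
      = foldEstimate f (u fun i => L (!true, i)) (fun i => L (true, i)) (fun i => U (true, i))
        + foldEstimate f (u fun i => L (!false, i)) (fun i => L (false, i))
          (fun i => U (false, i)) := by
  simp only [muHat, foldEstimate, resid, fitLabelled, fitUnlabelled, crossFit,
    Fintype.sum_prod_type, Fintype.sum_bool]
  ring

lemma foldEstimate_sub_half (hN : N ≠ 0) (f : Rd d → ℝ) (e : 𝒱 → ℝ) (m c : ℝ)
    (T : Fin N → Rd d × 𝒱) (U : Fin h → 𝒱) :
    foldEstimate f e T U - m / 2
      = (1 / (2 * N : ℝ)) * ∑ i, (f (T i).1 - e (T i).2 - (m - c))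
        + ((1 / (2 * N + 2 * h : ℝ)) * ∑ i, (e (T i).2 - c)
          + (1 / (2 * N + 2 * h : ℝ)) * ∑ i, (e (U i) - c)) := by
  have : (2 * N + 2 * h : ℝ) ≠ 0 := by positivity
  simp only [foldEstimate, Finset.sum_sub_distrib, Finset.sum_const, Finset.card_univ,
    Fintype.card_fin, nsmul_eq_mul]
  field_simp
  ring

/-- The centring constant `m` is arbitrary because an empirical mean minimises the empirical
squared deviation. -/
lemma sigmaSq_le (hN : N ≠ 0) (f : Rd d → ℝ) (u : (Fin N → Rd d × 𝒱) → 𝒱 → ℝ) (m : ℝ)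
    (L : Bool × Fin N → Rd d × 𝒱) (U : Bool × Fin h → 𝒱) :
    sigmaSq f u L U ≤ (1 / (2 * N : ℝ)) ^ 2 * ∑ i, resid f u L i ^ 2
      + (1 / (2 * N + 2 * h : ℝ)) ^ 2 *
        (∑ i, (fitLabelled u L i - m) ^ 2 + ∑ i, (fitUnlabelled u L U i - m) ^ 2) := by
  have hone : sigmaSqOne f u L ≤ (1 / (2 * N : ℝ)) * ∑ i, resid f u L i ^ 2 :=
    sub_le_self _ (sq_nonneg _)
  have htwo : sigmaSqTwo u L U ≤ (1 / (2 * N + 2 * h : ℝ)) *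
      (∑ i, (fitLabelled u L i - m) ^ 2 + ∑ i, (fitUnlabelled u L U i - m) ^ 2) := by
    have hdiff : (1 / (2 * N + 2 * h : ℝ)) *
        (∑ i, (fitLabelled u L i - m) ^ 2 + ∑ i, (fitUnlabelled u L U i - m) ^ 2)
        - sigmaSqTwo u L U = ((1 / (2 * N + 2 * h : ℝ)) *
          (∑ i, fitLabelled u L i + ∑ i, fitUnlabelled u L U i) - m) ^ 2 := by
      simp only [sigmaSqTwo, sub_sq, Finset.sum_add_distrib, Finset.sum_sub_distrib,
        Finset.sum_const, Finset.card_univ, Fintype.card_prod, Fintype.card_bool,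
        Fintype.card_fin, nsmul_eq_mul, ← Finset.sum_mul, ← Finset.mul_sum]
      push_cast
      field_simp
      ring
    exact sub_nonneg.1 (hdiff ▸ sq_nonneg _)
  calc sigmaSq f u L U
      ≤ (1 / (2 * N : ℝ)) * ((1 / (2 * N : ℝ)) * ∑ i, resid f u L i ^ 2)
        + (1 / (2 * N + 2 * h : ℝ)) * ((1 / (2 * N + 2 * h : ℝ)) *
          (∑ i, (fitLabelled u L i - m) ^ 2 + ∑ i, (fitUnlabelled u L U i - m) ^ 2)) := by
        unfold sigmaSq
        gcongr
    _ = _ := by ring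

lemma ofReal_sigmaSq_le (hN : N ≠ 0) (f : Rd d → ℝ) (u : (Fin N → Rd d × 𝒱) → 𝒱 → ℝ) (m : ℝ)
    (L : Bool × Fin N → Rd d × 𝒱) (U : Bool × Fin h → 𝒱) :
    ENNReal.ofReal (sigmaSq f u L U)
      ≤ ENNReal.ofReal ((1 / (2 * N : ℝ)) ^ 2) * ENNReal.ofReal (∑ i, resid f u L i ^ 2)
        + ENNReal.ofReal ((1 / (2 * N + 2 * h : ℝ)) ^ 2)
          * (ENNReal.ofReal (∑ i, (fitLabelled u L i - m) ^ 2)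
            + ENNReal.ofReal (∑ i, (fitUnlabelled u L U i - m) ^ 2)) := by
  rw [← ENNReal.ofReal_add (by positivity) (by positivity), ← ENNReal.ofReal_mul (by positivity),
    ← ENNReal.ofReal_mul (by positivity), ← ENNReal.ofReal_add (by positivity) (by positivity)]
  exact ENNReal.ofReal_le_ofReal (sigmaSq_le hN f u m L U)

variable [MeasurableSpace 𝒱] {ρ : Measure (Rd d × 𝒱)} {f : Rd d → ℝ} {e : 𝒱 → ℝ}

lemma secondMoment_fit_sub_le (ρ : Measure (Rd d × 𝒱)) (hf : Measurable f) (e : 𝒱 → ℝ) (m : ℝ) :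
    secondMoment (fun z => e z.2 - m) ρ
      ≤ 2 * (secondMoment (fun z => f z.1 - e z.2) ρ
        + secondMoment (fun x => f x - m) ρ.fst) := by
  have hmap : secondMoment (fun z : Rd d × 𝒱 => f z.1 - m) ρ
      = secondMoment (fun x => f x - m) ρ.fst :=
    secondMoment_comp (g := fun x => f x - m) ⟨measurable_fst, rfl⟩ (by fun_prop)
  have hsub := secondMoment_sub_le (μ := ρ) (f := fun z => f z.1 - m) (by fun_prop)
    (fun z => f z.1 - e z.2)
  rw [hmap, add_comm, ← mul_add] at hsub
  simpa only [sub_sub_sub_cancel_left, sub_sub_sub_cancel_right, sub_sub_cancel_left] using hsub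

lemma secondMoment_fit_snd (ρ : Measure (Rd d × 𝒱)) (he : Measurable e) (m : ℝ) :
    secondMoment (fun v => e v - m) ρ.snd = secondMoment (fun z => e z.2 - m) ρ :=
  (secondMoment_comp (g := fun v => e v - m) ⟨measurable_snd, rfl⟩ (by fun_prop)).symm

lemma four_mul_ofReal_weight_le (hN : N ≠ 0) (h : ℕ) :
    4 * (ENNReal.ofReal ((1 / (2 * N + 2 * h : ℝ)) ^ 2) * (N + h)) ≤ ENNReal.ofReal (1 / N) := by
  rw [← ENNReal.ofReal_natCast N, ← ENNReal.ofReal_natCast h, ← ENNReal.ofReal_ofNat 4,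
    ← ENNReal.ofReal_add (by positivity) (by positivity), ← ENNReal.ofReal_mul (by positivity),
    ← ENNReal.ofReal_mul (by positivity)]
  refine ENNReal.ofReal_le_ofReal ?_
  calc 4 * ((1 / (2 * N + 2 * h : ℝ)) ^ 2 * (N + h)) = 1 / (N + h) := by field_simp; ring
    _ ≤ 1 / N := by gcongr; simp

lemma weighted_le (hN : N ≠ 0) (h : ℕ) (R V : ℝ≥0∞) :
    2 * (ENNReal.ofReal ((1 / (2 * N : ℝ)) ^ 2) * (N * R))
        + 4 * (ENNReal.ofReal ((1 / (2 * N + 2 * h : ℝ)) ^ 2)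
          * (N * (2 * (R + V)) + h * (2 * (R + V))))
      ≤ 3 * (ENNReal.ofReal (1 / N) * (R + V)) := by
  have hzero := four_mul_ofReal_weight_le hN 0
  simp only [Nat.cast_zero, mul_zero, add_zero] at hzero
  calc _ ≤ 4 * (ENNReal.ofReal ((1 / (2 * N : ℝ)) ^ 2) * (N * (R + V)))
        + 4 * (ENNReal.ofReal ((1 / (2 * N + 2 * h : ℝ)) ^ 2)
          * (N * (2 * (R + V)) + h * (2 * (R + V)))) := by
        gcongr
        · norm_num
        · exact le_self_add
    _ = 4 * (ENNReal.ofReal ((1 / (2 * N : ℝ)) ^ 2) * N) * (R + V)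
        + 4 * (ENNReal.ofReal ((1 / (2 * N + 2 * h : ℝ)) ^ 2) * (N + h)) * (2 * (R + V)) := by
        ring
    _ ≤ ENNReal.ofReal (1 / N) * (R + V) + ENNReal.ofReal (1 / N) * (2 * (R + V)) := by
        gcongr
        exact four_mul_ofReal_weight_le hN h
    _ = 3 * (ENNReal.ofReal (1 / N) * (R + V)) := by ring

lemma integral_fst_sub_snd [IsProbabilityMeasure ρ] (hf : Measurable f) (hfL2 : MemLp f 2 ρ.fst)
    (he : Measurable e) (hR : secondMoment (fun z => f z.1 - e z.2) ρ ≠ ∞) :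
    ∫ z, (f z.1 - e z.2) ∂ρ = ∫ x, f x ∂ρ.fst - ∫ v, e v ∂ρ.snd := by
  have hfst : MemLp (fun z : Rd d × 𝒱 => f z.1) 2 ρ :=
    hfL2.comp_measurePreserving ⟨measurable_fst, rfl⟩
  have hresid : MemLp (fun z : Rd d × 𝒱 => f z.1 - e z.2) 2 ρ :=
    memLp_two_of_secondMoment_ne_top (by fun_prop) hR
  have hsnd : MemLp (fun z : Rd d × 𝒱 => e z.2) 2 ρ := by
    simpa only [Pi.sub_def, sub_sub_cancel] using hfst.sub hresid
  rw [integral_sub (hfst.integrable one_le_two) (hsnd.integrable one_le_two), Measure.fst,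
    Measure.snd, integral_map (by fun_prop) (by fun_prop),
    integral_map (by fun_prop) (by fun_prop)]

lemma secondMoment_foldEstimate_sub_half_le [IsProbabilityMeasure ρ] (hN : N ≠ 0)
    (hf : Measurable f) (he : Measurable e) (m c : ℝ) :
    secondMoment (fun p => foldEstimate f e p.1 p.2 - m / 2)
        ((Measure.pi fun _ : Fin N => ρ).prod (Measure.pi fun _ : Fin h => ρ.snd))
      ≤ 2 * (ENNReal.ofReal ((1 / (2 * N : ℝ)) ^ 2) * secondMoment (fun T : Fin N → Rd d × 𝒱 =>
            ∑ i, (f (T i).1 - e (T i).2 - (m - c))) (Measure.pi fun _ => ρ))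
        + 4 * (ENNReal.ofReal ((1 / (2 * N + 2 * h : ℝ)) ^ 2) *
          (secondMoment (fun T : Fin N → Rd d × 𝒱 => ∑ i, (e (T i).2 - c))
              (Measure.pi fun _ => ρ)
            + secondMoment (fun U : Fin h → 𝒱 => ∑ i, (e (U i) - c))
              (Measure.pi fun _ => ρ.snd))) := by
  simp only [foldEstimate_sub_half hN f e m c]
  refine (secondMoment_add_le (by fun_prop) _).trans ?_
  grw [secondMoment_add_le (by fun_prop)]
  simp only [secondMoment_const_mul]
  rw [secondMoment_comp (g := fun T : Fin N → Rd d × 𝒱 =>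
      ∑ i, (f (T i).1 - e (T i).2 - (m - c))) measurePreserving_fst (by fun_prop),
    secondMoment_comp (g := fun T : Fin N → Rd d × 𝒱 => ∑ i, (e (T i).2 - c))
      measurePreserving_fst (by fun_prop),
    secondMoment_comp (g := fun U : Fin h → 𝒱 => ∑ i, (e (U i) - c))
      measurePreserving_snd (by fun_prop)]
  exact le_of_eq (by ring)

lemma secondMoment_foldEstimate_sub_le [IsProbabilityMeasure ρ] (hN : N ≠ 0) (hf : Measurable f)
    (hfL2 : MemLp f 2 ρ.fst) (he : Measurable e) :
    secondMoment (fun p => foldEstimate f e p.1 p.2 - (∫ x, f x ∂ρ.fst) / 2)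
        ((Measure.pi fun _ : Fin N => ρ).prod (Measure.pi fun _ : Fin h => ρ.snd))
      ≤ 3 * (ENNReal.ofReal (1 / N)
        * (secondMoment (fun z => f z.1 - e z.2) ρ + evariance f ρ.fst)) := by
  set R := secondMoment (fun z => f z.1 - e z.2) ρ with hRdef
  set m := ∫ x, f x ∂ρ.fst with hm
  set c := ∫ v, e v ∂ρ.snd with hc
  by_cases hR : R = ∞
  · rw [hR, top_add, ENNReal.mul_top (by simpa using by positivity), ENNReal.mul_top three_ne_zero]
    exact le_top
  have hresid := secondMoment_sum_sub_integral_le (ι := Fin N) (μ := ρ)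
    (g := fun z => f z.1 - e z.2) (by fun_prop) 0
  have hlabelled := secondMoment_sum_sub_integral_le (ι := Fin N) (μ := ρ)
    (he.comp measurable_snd).aestronglyMeasurable m
  have hunlabelled := secondMoment_sum_sub_integral_le (ι := Fin h) (μ := ρ.snd)
    he.aestronglyMeasurable m
  have hcsnd : ∫ z, e z.2 ∂ρ = c := by
    rw [hc, Measure.snd, integral_map (by fun_prop) (by fun_prop)]
  simp only [integral_fst_sub_snd hf hfL2 he hR, Fintype.card_fin, sub_zero, ← hRdef, ← hm,
    ← hc] at hresid
  simp only [Function.comp_apply, hcsnd, Fintype.card_fin] at hlabelled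
  simp only [secondMoment_fit_snd ρ he, Fintype.card_fin] at hunlabelled
  have hfit := secondMoment_fit_sub_le ρ hf e m
  rw [← evariance_eq_secondMoment, ← hRdef] at hfit
  set V := evariance f ρ.fst
  calc _ ≤ 2 * (ENNReal.ofReal ((1 / (2 * N : ℝ)) ^ 2) * (N * R))
        + 4 * (ENNReal.ofReal ((1 / (2 * N + 2 * h : ℝ)) ^ 2) *
          (N * (2 * (R + V)) + h * (2 * (R + V)))) := by
        grw [secondMoment_foldEstimate_sub_half_le hN hf he m c, hresid, hlabelled,
          hunlabelled, hfit]
    _ ≤ _ := weighted_le hN h R V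

/-- The labelled and the unlabelled part of one of the two samples. -/
abbrev Sample (d N h : ℕ) (𝒱 : Type*) : Type _ :=
  (Bool × Fin N → Rd d × 𝒱) × (Bool × Fin h → 𝒱)

/-- The law of one sample: `2 N` i.i.d. labelled points from `ρ` and `2 h` independent i.i.d.
unlabelled points from its second marginal. -/
noncomputable def sampleLaw (N h : ℕ) (ρ : Measure (Rd d × 𝒱)) : Measure (Sample d N h 𝒱) :=
  (Measure.pi fun _ => ρ).prod (Measure.pi fun _ => ρ.snd)

/-- The mean squared error `E[{f(Z) - û(T)}²]` of the regression procedure `u` for a fixed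
function `f`, where `û` is trained on `N` i.i.d. points from `ρ` and `(Z, T)` is a fresh point. -/
noncomputable def meanSquaredResidual (f : Rd d → ℝ) (u : (Fin N → Rd d × 𝒱) → 𝒱 → ℝ)
    (ρ : Measure (Rd d × 𝒱)) : ℝ≥0∞ :=
  ∫⁻ S, secondMoment (fun z => f z.1 - u S z.2) ρ ∂(Measure.pi fun _ : Fin N => ρ)

variable {u : (Fin N → Rd d × 𝒱) → 𝒱 → ℝ} [IsProbabilityMeasure ρ]

instance : IsProbabilityMeasure (sampleLaw N h ρ) := by unfold sampleLaw; infer_instance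

lemma measurePreserving_sample_fold (ρ : Measure (Rd d × 𝒱)) [IsProbabilityMeasure ρ] (j : Bool) :
    MeasurePreserving (fun x : Sample d N h 𝒱 =>
        ((fun i => x.1 (!j, i)), ((fun i => x.1 (j, i)), fun i => x.2 (j, i))))
      (sampleLaw N h ρ) ((Measure.pi fun _ => ρ).prod
        ((Measure.pi fun _ => ρ).prod (Measure.pi fun _ => ρ.snd))) :=
  (measurePreserving_prodAssoc _ _ _).comp
    ((measurePreserving_folds ρ j).prod (measurePreserving_fold ρ.snd j))

lemma measurePreserving_sample_labelled (ρ : Measure (Rd d × 𝒱)) [IsProbabilityMeasure ρ]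
    (i : Bool × Fin N) :
    MeasurePreserving (fun x : Sample d N h 𝒱 => ((fun k => x.1 (!i.1, k)), x.1 i))
      (sampleLaw N h ρ) ((Measure.pi fun _ => ρ).prod ρ) :=
  ((MeasurePreserving.id _).prod
    ((measurePreserving_eval (fun _ : Fin N => ρ) i.2).comp measurePreserving_fst)).comp
      (measurePreserving_sample_fold ρ i.1)

lemma measurePreserving_sample_unlabelled (ρ : Measure (Rd d × 𝒱)) [IsProbabilityMeasure ρ]
    (i : Bool × Fin h) :
    MeasurePreserving (fun x : Sample d N h 𝒱 => ((fun k => x.1 (!i.1, k)), x.2 i))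
      (sampleLaw N h ρ) ((Measure.pi fun _ => ρ).prod ρ.snd) :=
  ((MeasurePreserving.id _).prod
    ((measurePreserving_eval (fun _ : Fin h => ρ.snd) i.2).comp measurePreserving_snd)).comp
      (measurePreserving_sample_fold ρ i.1)

lemma measurable_foldEstimate (hf : Measurable f)
    (hu : Measurable fun z : (Fin N → Rd d × 𝒱) × 𝒱 => u z.1 z.2) :
    Measurable fun p : (Fin N → Rd d × 𝒱) × ((Fin N → Rd d × 𝒱) × (Fin h → 𝒱)) =>
      foldEstimate f (u p.1) p.2.1 p.2.2 := by
  unfold foldEstimate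
  fun_prop

lemma secondMoment_fold_le (hN : N ≠ 0) (hf : Measurable f) (hfL2 : MemLp f 2 ρ.fst)
    (hu : Measurable fun z : (Fin N → Rd d × 𝒱) × 𝒱 => u z.1 z.2) (j : Bool) :
    secondMoment (fun x : Sample d N h 𝒱 => foldEstimate f (u fun i => x.1 (!j, i))
        (fun i => x.1 (j, i)) (fun i => x.2 (j, i)) - (∫ x, f x ∂ρ.fst) / 2) (sampleLaw N h ρ)
      ≤ 3 * (ENNReal.ofReal (1 / N) * (meanSquaredResidual f u ρ + evariance f ρ.fst)) := by
  have hmeas := (measurable_foldEstimate (h := h) hf hu).sub_const ((∫ x, f x ∂ρ.fst) / 2)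
  calc _ = ∫⁻ S, secondMoment (fun p => foldEstimate f (u S) p.1 p.2 - (∫ x, f x ∂ρ.fst) / 2)
        ((Measure.pi fun _ : Fin N => ρ).prod (Measure.pi fun _ : Fin h => ρ.snd))
        ∂(Measure.pi fun _ : Fin N => ρ) := by
        rw [← secondMoment_prod hmeas, ← secondMoment_comp (measurePreserving_sample_fold ρ j)
          hmeas]
    _ ≤ ∫⁻ S, 3 * (ENNReal.ofReal (1 / N)
        * (secondMoment (fun z => f z.1 - u S z.2) ρ + evariance f ρ.fst))
        ∂(Measure.pi fun _ : Fin N => ρ) :=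
        lintegral_mono fun S => secondMoment_foldEstimate_sub_le hN hf hfL2
          (hu.comp measurable_prodMk_left)
    _ = _ := by
        rw [lintegral_const_mul' _ _ ENNReal.ofNat_ne_top,
          lintegral_const_mul' _ _ ENNReal.ofReal_ne_top, lintegral_add_right _ measurable_const,
          lintegral_const, measure_univ, mul_one]
        rfl

lemma secondMoment_muHat_sub_le (hN : N ≠ 0) (hf : Measurable f) (hfL2 : MemLp f 2 ρ.fst)
    (hu : Measurable fun z : (Fin N → Rd d × 𝒱) × 𝒱 => u z.1 z.2) :
    secondMoment (fun x => muHat f u x.1 x.2 - ∫ x, f x ∂ρ.fst) (sampleLaw N h ρ)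
      ≤ 12 * (ENNReal.ofReal (1 / N) * (meanSquaredResidual f u ρ + evariance f ρ.fst)) := by
  set m := ∫ x, f x ∂ρ.fst
  let foldError (j : Bool) (x : Sample d N h 𝒱) : ℝ := foldEstimate f (u fun i => x.1 (!j, i))
    (fun i => x.1 (j, i)) (fun i => x.2 (j, i)) - m / 2
  have hmeas : Measurable (foldError true) := ((measurable_foldEstimate hf hu).comp
    (measurePreserving_sample_fold ρ true).measurable).sub_const (m / 2)
  have hsplit (x : Sample d N h 𝒱) :
      muHat f u x.1 x.2 - m = foldError true x + foldError false x := by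
    simp only [muHat_eq_foldEstimate_add, foldError]
    ring
  simp only [hsplit]
  grw [secondMoment_add_le hmeas.aemeasurable, secondMoment_fold_le hN hf hfL2 hu true,
    secondMoment_fold_le hN hf hfL2 hu false]
  exact le_of_eq (by ring)

lemma lintegral_secondMoment_fit_sub_le (hf : Measurable f) (u : (Fin N → Rd d × 𝒱) → 𝒱 → ℝ)
    (m : ℝ) :
    ∫⁻ S, secondMoment (fun z => u S z.2 - m) ρ ∂(Measure.pi fun _ : Fin N => ρ)
      ≤ 2 * (meanSquaredResidual f u ρ + secondMoment (fun x => f x - m) ρ.fst) := by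
  grw [lintegral_mono fun S => secondMoment_fit_sub_le ρ hf (u S) m]
  rw [lintegral_const_mul' _ _ ENNReal.ofNat_ne_top, lintegral_add_right _ measurable_const,
    lintegral_const, measure_univ, mul_one, meanSquaredResidual]

lemma secondMoment_fitLabelled_sub (hu : Measurable fun z : (Fin N → Rd d × 𝒱) × 𝒱 => u z.1 z.2)
    (m : ℝ) (i : Bool × Fin N) :
    secondMoment (fun x => fitLabelled u x.1 i - m) (sampleLaw N h ρ)
      = ∫⁻ S, secondMoment (fun z => u S z.2 - m) ρ ∂(Measure.pi fun _ : Fin N => ρ) := by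
  have hmeas : Measurable fun p : (Fin N → Rd d × 𝒱) × (Rd d × 𝒱) => u p.1 p.2.2 - m := by
    fun_prop
  exact (secondMoment_comp (measurePreserving_sample_labelled ρ i) hmeas).trans
    (secondMoment_prod hmeas)

lemma secondMoment_fitUnlabelled_sub
    (hu : Measurable fun z : (Fin N → Rd d × 𝒱) × 𝒱 => u z.1 z.2) (m : ℝ) (i : Bool × Fin h) :
    secondMoment (fun x => fitUnlabelled u x.1 x.2 i - m) (sampleLaw N h ρ)
      = ∫⁻ S, secondMoment (fun z => u S z.2 - m) ρ ∂(Measure.pi fun _ : Fin N => ρ) := by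
  have hmeas : Measurable fun p : (Fin N → Rd d × 𝒱) × 𝒱 => u p.1 p.2 - m := by fun_prop
  have hu' (S : Fin N → Rd d × 𝒱) : Measurable (u S) := hu.comp measurable_prodMk_left
  simp only [← secondMoment_fit_snd ρ (hu' _)]
  exact (secondMoment_comp (measurePreserving_sample_unlabelled ρ i) hmeas).trans
    (secondMoment_prod hmeas)

lemma secondMoment_resid (hf : Measurable f)
    (hu : Measurable fun z : (Fin N → Rd d × 𝒱) × 𝒱 => u z.1 z.2) (i : Bool × Fin N) :
    secondMoment (fun x => resid f u x.1 i) (sampleLaw N h ρ) = meanSquaredResidual f u ρ := by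
  have hmeas : Measurable fun p : (Fin N → Rd d × 𝒱) × (Rd d × 𝒱) => f p.2.1 - u p.1 p.2.2 := by
    fun_prop
  exact (secondMoment_comp (measurePreserving_sample_labelled ρ i) hmeas).trans
    (secondMoment_prod hmeas)

lemma measurable_fitLabelled (hu : Measurable fun z : (Fin N → Rd d × 𝒱) × 𝒱 => u z.1 z.2)
    (i : Bool × Fin N) : Measurable fun x : Sample d N h 𝒱 => fitLabelled u x.1 i := by
  unfold fitLabelled crossFit
  fun_prop

lemma measurable_fitUnlabelled (hu : Measurable fun z : (Fin N → Rd d × 𝒱) × 𝒱 => u z.1 z.2)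
    (i : Bool × Fin h) : Measurable fun x : Sample d N h 𝒱 => fitUnlabelled u x.1 x.2 i := by
  unfold fitUnlabelled crossFit
  fun_prop

lemma lintegral_sigmaSq_le (hN : N ≠ 0) (hf : Measurable f)
    (hu : Measurable fun z : (Fin N → Rd d × 𝒱) × 𝒱 => u z.1 z.2) :
    ∫⁻ x, ENNReal.ofReal (sigmaSq f u x.1 x.2) ∂(sampleLaw N h ρ)
      ≤ 3 * (ENNReal.ofReal (1 / N) * (meanSquaredResidual f u ρ + evariance f ρ.fst)) := by
  set R := meanSquaredResidual f u ρ
  set V := evariance f ρ.fst with hV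
  set m := ∫ x, f x ∂ρ.fst
  have hfit := lintegral_secondMoment_fit_sub_le (ρ := ρ) hf u m
  rw [← evariance_eq_secondMoment, ← hV] at hfit
  have hlabelled := measurable_fitLabelled (h := h) hu
  have hunlabelled := measurable_fitUnlabelled (h := h) hu
  have hresid (i : Bool × Fin N) : Measurable fun x : Sample d N h 𝒱 => resid f u x.1 i := by
    unfold resid
    fun_prop
  calc _ ≤ ∫⁻ x : Sample d N h 𝒱, (ENNReal.ofReal ((1 / (2 * N : ℝ)) ^ 2)
          * ENNReal.ofReal (∑ i, resid f u x.1 i ^ 2)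
        + ENNReal.ofReal ((1 / (2 * N + 2 * h : ℝ)) ^ 2)
          * (ENNReal.ofReal (∑ i, (fitLabelled u x.1 i - m) ^ 2)
            + ENNReal.ofReal (∑ i, (fitUnlabelled u x.1 x.2 i - m) ^ 2)))
        ∂(sampleLaw N h ρ) := lintegral_mono fun x => ofReal_sigmaSq_le hN f u m x.1 x.2
    _ ≤ ENNReal.ofReal ((1 / (2 * N : ℝ)) ^ 2) * (Fintype.card (Bool × Fin N) * R)
        + ENNReal.ofReal ((1 / (2 * N + 2 * h : ℝ)) ^ 2)
          * (Fintype.card (Bool × Fin N) * (2 * (R + V))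
            + Fintype.card (Bool × Fin h) * (2 * (R + V))) := by
        rw [lintegral_add_left (by fun_prop), lintegral_const_mul' _ _ ENNReal.ofReal_ne_top,
          lintegral_const_mul' _ _ ENNReal.ofReal_ne_top, lintegral_add_left (by fun_prop)]
        gcongr
        · exact lintegral_ofReal_sum_sq_le hresid fun i => (secondMoment_resid hf hu i).le
        · exact lintegral_ofReal_sum_sq_le (fun i => by fun_prop)
            fun i => (secondMoment_fitLabelled_sub hu m i).trans_le hfit
        · exact lintegral_ofReal_sum_sq_le (fun i => by fun_prop)
            fun i => (secondMoment_fitUnlabelled_sub hu m i).trans_le hfit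
    _ ≤ 2 * (ENNReal.ofReal ((1 / (2 * N : ℝ)) ^ 2) * (N * R))
        + 4 * (ENNReal.ofReal ((1 / (2 * N + 2 * h : ℝ)) ^ 2)
          * (N * (2 * (R + V)) + h * (2 * (R + V)))) := by
        simp only [Fintype.card_prod, Fintype.card_bool, Fintype.card_fin, Nat.cast_mul,
          Nat.cast_ofNat]
        refine add_le_add (le_of_eq (by ring)) ?_
        rw [mul_assoc, mul_assoc, ← mul_add, ← mul_add, mul_left_comm]
        gcongr
        norm_num
    _ ≤ _ := weighted_le hN h R V

end CrossFitBounds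

section FourierTransform

variable {E : Type*} [NormedAddCommGroup E] [InnerProductSpace ℝ E] [FiniteDimensional ℝ E]
  [MeasurableSpace E] [BorelSpace E]

lemma integral_fourier_mul_eq_flip {f g : E → ℂ} (hf : Integrable f) (hg : Integrable g) :
    ∫ x, 𝓕 f x * g x = ∫ x, f x * 𝓕 g x := by
  simpa using! VectorFourier.integral_fourierIntegral_smul_eq_flip (L := innerₗ E)
    Real.continuous_fourierChar continuous_inner hf hg

lemma integral_fourierInv_mul_eq_flip {f g : E → ℂ} (hf : Integrable f) (hg : Integrable g) :
    ∫ x, 𝓕⁻ f x * g x = ∫ x, f x * 𝓕⁻ g x := by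
  rw [Real.fourierInv_eq_fourier_comp_neg, integral_fourier_mul_eq_flip hf.comp_neg hg,
    ← integral_neg_eq_self]
  simp only [neg_neg, Real.fourierInv_eq_fourier_neg]

open SchwartzMap in
lemma ae_eq_fourierInv_toLp_fourier {g : E → ℂ} (hg : Integrable g) (hF : MemLp (𝓕 g) 2) :
    g =ᵐ[volume] (𝓕⁻ hF.toLp : Lp ℂ 2 (volume : Measure E)) := by
  set k : Lp ℂ 2 (volume : Measure E) := 𝓕⁻ hF.toLp with hk
  refine ae_eq_of_integral_contDiff_smul_eq hg.locallyIntegrable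
    ((Lp.memLp k).locallyIntegrable one_le_two) fun φ hφ hφc => ?_
  have hφcC : HasCompactSupport (Complex.ofRealCLM ∘ φ) := hφc.comp_left rfl
  have hφC : ContDiff ℝ (⊤ : ℕ∞) (Complex.ofRealCLM ∘ φ) := by fun_prop
  set ψ : 𝓢(E, ℂ) := hφcC.toSchwartzMap hφC with hψ
  calc ∫ x, φ x • g x
    _ = ∫ x, 𝓕 ((𝓕⁻ ψ : 𝓢(E, ℂ)) : E → ℂ) x * g x := by
      rw [← SchwartzMap.fourier_coe, FourierTransform.fourier_fourierInv_eq]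
      simp [hψ]
    _ = ∫ x, (𝓕⁻ ψ : 𝓢(E, ℂ)) x * 𝓕 g x :=
      integral_fourier_mul_eq_flip (𝓕⁻ ψ : 𝓢(E, ℂ)).integrable hg
    _ = ∫ x, (𝓕⁻ ψ : 𝓢(E, ℂ)) x • (hF.toLp : Lp ℂ 2 (volume : Measure E)) x := by
      refine integral_congr_ae ?_
      filter_upwards [hF.coeFn_toLp] with x hx
      rw [hx, smul_eq_mul]
    _ = Lp.toTemperedDistribution k ψ := by
      rw [hk, ← Lp.fourierInv_toTemperedDistribution_eq, TemperedDistribution.fourierInv_apply,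
        Lp.toTemperedDistribution_apply]
    _ = ∫ x, φ x • k x := by simp [hψ]

lemma eLpNorm_two_fourier {g : E → ℂ} (hg : Integrable g) (hF : MemLp (𝓕 g) 2) :
    eLpNorm (𝓕 g) 2 volume = eLpNorm g 2 volume := by
  rw [eLpNorm_congr_ae (ae_eq_fourierInv_toLp_fourier hg hF), ← eLpNorm_congr_ae hF.coeFn_toLp,
    ← Lp.enorm_def, ← Lp.enorm_def, ← ofReal_norm, ← ofReal_norm,
    ← Lp.norm_fourier_eq (𝓕⁻ hF.toLp), FourierTransform.fourier_fourierInv_eq]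

lemma continuous_fourier {g : E → ℂ} (hg : Integrable g) : Continuous (𝓕 g) :=
  VectorFourier.fourierIntegral_continuous Real.continuous_fourierChar continuous_inner hg

lemma norm_fourier_le_integral_norm (g : E → ℂ) (v : E) : ‖𝓕 g v‖ ≤ ∫ x, ‖g x‖ :=
  VectorFourier.norm_fourierIntegral_le_integral_norm ..

lemma fourierInv_conj (g : E → ℂ) (v : E) :
    𝓕⁻ (fun x => starRingEnd ℂ (g x)) v = starRingEnd ℂ (𝓕 g v) := by
  rw [Real.fourierInv_eq', Real.fourier_eq', ← integral_conj]
  refine integral_congr_ae (ae_of_all _ fun x => ?_)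
  simp [← Complex.exp_conj, Complex.conj_ofNat]

lemma integrable_mul_fourier {φ g : E → ℂ} (hφ : Integrable φ) (hg : Integrable g) :
    Integrable fun v => φ v * 𝓕 g v :=
  hφ.mul_bdd (continuous_fourier hg).aestronglyMeasurable
    (ae_of_all _ (norm_fourier_le_integral_norm g))

lemma integral_fourierInv_sub_mul {φ g : E → ℂ} (hφ : Integrable φ) (hg : Integrable g)
    (x : E) : ∫ y, 𝓕⁻ φ (x - y) * g y = 𝓕⁻ (fun v => φ v * 𝓕 g v) x := by
  set e : E → ℂ := fun v => Complex.exp (↑(2 * Real.pi * inner ℝ v x) * Complex.I) * φ v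
  have he : Integrable e :=
    hφ.bdd_mul (c := 1) (Continuous.aestronglyMeasurable (by fun_prop))
      (ae_of_all _ fun v => (Complex.norm_exp_ofReal_mul_I _).le)
  have hshift : ∀ y, 𝓕⁻ φ (x - y) = 𝓕 e y := by
    intro y
    rw [Real.fourierInv_eq', Real.fourier_eq']
    refine integral_congr_ae (ae_of_all _ fun v => ?_)
    simp only [e, smul_eq_mul, ← mul_assoc, ← Complex.exp_add, inner_sub_right]
    congr 2
    push_cast
    ring
  simp only [hshift]
  rw [integral_fourier_mul_eq_flip he hg, Real.fourierInv_eq']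
  simp only [e, smul_eq_mul, mul_assoc]

lemma integral_conj_mul_integral_fourierInv_sub_mul {φ g : E → ℂ} (hφ : Integrable φ)
    (hg : Integrable g) :
    ∫ x, starRingEnd ℂ (g x) * ∫ y, 𝓕⁻ φ (x - y) * g y = ∫ v, φ v * (‖𝓕 g v‖ ^ 2 : ℝ) := by
  have hconj : Integrable fun x => starRingEnd ℂ (g x) := Complex.conjLIE.integrable_comp_iff.2 hg
  simp only [integral_fourierInv_sub_mul hφ hg, mul_comm (starRingEnd ℂ _)]
  rw [integral_fourierInv_mul_eq_flip (integrable_mul_fourier hφ hg) hconj]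
  refine integral_congr_ae (ae_of_all _ fun v => ?_)
  simp only [fourierInv_conj, mul_assoc, Complex.mul_conj, Complex.normSq_eq_norm_sq]

end FourierTransform

section Sobolev

variable {E : Type*} [NormedAddCommGroup E] [InnerProductSpace ℝ E] [FiniteDimensional ℝ E]
  [MeasurableSpace E] [BorelSpace E] {β : ℝ} {f g : E → ℝ}

/-- The Fourier transform of a real function. -/
noncomputable def fourierReal (f : E → ℝ) : E → ℂ := 𝓕 fun x => (f x : ℂ)

/-- The squared Sobolev norm `∫ (1 + ‖ω‖²)^β |𝓕 f(ω)|² dω`, whose sublevel sets are the Sobolev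
balls. -/
noncomputable def sobolevEnergy (β : ℝ) (f : E → ℝ) : ℝ≥0∞ :=
  ∫⁻ ω, ENNReal.ofReal ((1 + ‖ω‖ ^ 2) ^ β * ‖fourierReal f ω‖ ^ 2)

lemma continuous_fourierReal (hf : Integrable f) : Continuous (fourierReal f) :=
  continuous_fourier hf.ofReal

lemma fourierReal_sub (hf : Integrable f) (hg : Integrable g) (ω : E) :
    fourierReal (f - g) ω = fourierReal f ω - fourierReal g ω := by
  simp only [fourierReal, Real.fourier_eq]
  rw [← integral_sub ((Real.fourierIntegral_convergent_iff ω).2 hf.ofReal)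
    ((Real.fourierIntegral_convergent_iff ω).2 hg.ofReal)]
  simp only [Pi.sub_apply, Complex.ofReal_sub, smul_sub]

lemma sobolevEnergy_sub_le (hf : Integrable f) (hg : Integrable g) :
    sobolevEnergy β (f - g) ≤ 2 * sobolevEnergy β f + 2 * sobolevEnergy β g := by
  have hmeas := (continuous_fourierReal hf).measurable
  simp only [sobolevEnergy]
  rw [← lintegral_const_mul' 2 _ ENNReal.ofNat_ne_top, ← lintegral_const_mul' 2 _
    ENNReal.ofNat_ne_top, ← lintegral_add_left (by fun_prop)]
  refine lintegral_mono fun ω => ?_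
  have hsq : ‖fourierReal (f - g) ω‖ ^ 2
      ≤ 2 * ‖fourierReal f ω‖ ^ 2 + 2 * ‖fourierReal g ω‖ ^ 2 := by
    rw [fourierReal_sub hf hg]
    grw [norm_sub_le]
    linarith [add_sq_le (a := ‖fourierReal f ω‖) (b := ‖fourierReal g ω‖)]
  rw [← ENNReal.ofReal_ofNat 2, ← ENNReal.ofReal_mul zero_le_two, ← ENNReal.ofReal_mul zero_le_two,
    ← ENNReal.ofReal_add (by positivity) (by positivity)]
  refine ENNReal.ofReal_le_ofReal ?_
  grw [hsq]
  exact le_of_eq (by ring)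

lemma lintegral_fourierReal_sq_le_sobolevEnergy (hβ : 0 ≤ β) (f : E → ℝ) :
    ∫⁻ ω, ENNReal.ofReal (‖fourierReal f ω‖ ^ 2) ≤ sobolevEnergy β f := by
  refine lintegral_mono fun ω => ENNReal.ofReal_le_ofReal ?_
  exact le_mul_of_one_le_left (sq_nonneg _)
    (Real.one_le_rpow (le_add_of_nonneg_right (sq_nonneg _)) hβ)

lemma secondMoment_eq_lintegral_fourierReal (hf : Integrable f)
    (hF : ∫⁻ ω, ENNReal.ofReal (‖fourierReal f ω‖ ^ 2) ≠ ⊤) :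
    secondMoment f volume = ∫⁻ ω, ENNReal.ofReal (‖fourierReal f ω‖ ^ 2) := by
  have hnorm : ∀ F : E → ℂ,
      eLpNorm F 2 volume ^ 2 = ∫⁻ x, ENNReal.ofReal (‖F x‖ ^ 2) := fun F => by
    simpa using eLpNorm_nnreal_pow_eq_lintegral (f := F) (μ := volume) (p := 2) two_ne_zero
  have hmem : MemLp (fourierReal f) 2 := by
    refine ⟨(continuous_fourierReal hf).aestronglyMeasurable, ?_⟩
    rw [← hnorm] at hF
    exact (ENNReal.pow_lt_top_iff.1 hF.lt_top).resolve_right two_ne_zero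
  have hfC : Integrable fun x => (f x : ℂ) := hf.ofReal
  rw [← hnorm, fourierReal, eLpNorm_two_fourier hfC hmem, hnorm, secondMoment]
  simp

/-- Frequencies `‖ω‖² ≤ s` are seen by the Gaussian, the others are controlled by the Sobolev
weight. -/
lemma one_le_exp_mul_exp_add_rpow_mul (hβ : 0 ≤ β) {s t : ℝ} (hs : 0 < s) (ht : 0 ≤ t) :
    1 ≤ Real.exp (Real.pi ^ 2) * Real.exp (-(Real.pi ^ 2 / s) * t) + s ^ (-β) * (1 + t) ^ β := by
  rcases le_total t s with hts | hst
  · have hexp : 1 ≤ Real.exp (Real.pi ^ 2) * Real.exp (-(Real.pi ^ 2 / s) * t) := by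
      rw [← Real.exp_add, Real.one_le_exp_iff]
      have : Real.pi ^ 2 / s * t ≤ Real.pi ^ 2 := by
        rw [div_mul_eq_mul_div, div_le_iff₀ hs]
        gcongr
      linarith
    exact hexp.trans (le_add_of_nonneg_right (by positivity))
  · have hpow : 1 ≤ s ^ (-β) * (1 + t) ^ β := by
      rw [Real.rpow_neg hs.le, ← div_eq_inv_mul, one_le_div (by positivity)]
      gcongr
      linarith
    exact hpow.trans (le_add_of_nonneg_left (by positivity))

lemma lintegral_fourierReal_sq_le (hβ : 0 ≤ β) {s : ℝ} (hs : 0 < s) (hf : Integrable f) :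
    ∫⁻ ω, ENNReal.ofReal (‖fourierReal f ω‖ ^ 2)
      ≤ ENNReal.ofReal (Real.exp (Real.pi ^ 2)) * (∫⁻ ω,
          ENNReal.ofReal (Real.exp (-(Real.pi ^ 2 / s) * ‖ω‖ ^ 2) * ‖fourierReal f ω‖ ^ 2))
        + ENNReal.ofReal (s ^ (-β)) * sobolevEnergy β f := by
  have hmeas := (continuous_fourierReal hf).measurable
  rw [sobolevEnergy, ← lintegral_const_mul' _ _ ENNReal.ofReal_ne_top,
    ← lintegral_const_mul' _ _ ENNReal.ofReal_ne_top, ← lintegral_add_left (by fun_prop)]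
  refine lintegral_mono fun ω => ?_
  rw [← ENNReal.ofReal_mul (by positivity), ← ENNReal.ofReal_mul (by positivity),
    ← ENNReal.ofReal_add (by positivity) (by positivity)]
  refine ENNReal.ofReal_le_ofReal ?_
  calc ‖fourierReal f ω‖ ^ 2
    _ ≤ (Real.exp (Real.pi ^ 2) * Real.exp (-(Real.pi ^ 2 / s) * ‖ω‖ ^ 2)
          + s ^ (-β) * (1 + ‖ω‖ ^ 2) ^ β) * ‖fourierReal f ω‖ ^ 2 :=
      le_mul_of_one_le_left (sq_nonneg _)
        (one_le_exp_mul_exp_add_rpow_mul hβ hs (sq_nonneg ‖ω‖))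
    _ = _ := by ring

end Sobolev

section GaussianEnergy

variable {d : ℕ} {s : ℝ}

/-- The total mass `(π / s)^{d / 2}` of the function `x ↦ exp(-s ‖x‖²)` on `ℝᵈ`. -/
noncomputable def kernelMass (d : ℕ) (s : ℝ) : ℝ := (Real.pi / s) ^ (d / 2 : ℝ)

lemma kernelMass_pos (d : ℕ) (hs : 0 < s) : 0 < kernelMass d s :=
  Real.rpow_pos_of_pos (div_pos Real.pi_pos hs) _

lemma gaussianKernel_eq_fourierInv (hs : 0 < s) (x y : Rd d) :
    (gaussianKernel s x y : ℂ) = kernelMass d s *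
      𝓕⁻ (fun v : Rd d => Complex.exp (-(Real.pi ^ 2 / s : ℝ) * ‖v‖ ^ 2)) (x - y) := by
  have hb : 0 < ((Real.pi ^ 2 / s : ℝ) : ℂ).re := by
    rw [Complex.ofReal_re]
    positivity
  have hmass : (kernelMass d s : ℂ) *
      (Real.pi / (Real.pi ^ 2 / s : ℝ) : ℂ) ^ (Module.finrank ℝ (Rd d) / 2 : ℂ) = 1 := by
    rw [finrank_euclideanSpace_fin, ← Complex.ofReal_div,
      show ((d : ℂ) / 2) = ((d / 2 : ℝ) : ℂ) by push_cast; rfl,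
      ← Complex.ofReal_cpow (by positivity), ← Complex.ofReal_mul, kernelMass,
      ← Real.mul_rpow (by positivity) (by positivity)]
    have : Real.pi / s * (Real.pi / (Real.pi ^ 2 / s)) = 1 := by field_simp
    rw [this, Real.one_rpow, Complex.ofReal_one]
  rw [Real.fourierInv_eq_fourier_neg, fourier_gaussian_innerProductSpace hb, ← mul_assoc, hmass,
    one_mul, gaussianKernel, Complex.ofReal_exp, norm_neg]
  congr 1
  push_cast
  field_simp

lemma integral_mul_integral_gaussianKernel_mul (hs : 0 < s) {g : Rd d → ℝ}
    (hg : Integrable g) :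
    ∫ x, g x * ∫ y, gaussianKernel s x y * g y
      = kernelMass d s *
        ∫ ω, Real.exp (-(Real.pi ^ 2 / s) * ‖ω‖ ^ 2) * ‖fourierReal g ω‖ ^ 2 := by
  have hφ : Integrable fun v : Rd d => Complex.exp (-(Real.pi ^ 2 / s : ℝ) * ‖v‖ ^ 2) := by
    have hb : 0 < ((Real.pi ^ 2 / s : ℝ) : ℂ).re := by
      rw [Complex.ofReal_re]
      positivity
    simpa using GaussianFourier.integrable_cexp_neg_mul_sq_norm_add hb 0 (0 : Rd d)
  have hgC : Integrable fun x => (g x : ℂ) := hg.ofReal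
  have hinner : ∀ x, ((∫ y, gaussianKernel s x y * g y : ℝ) : ℂ) = kernelMass d s * ∫ y,
      𝓕⁻ (fun v : Rd d => Complex.exp (-(Real.pi ^ 2 / s : ℝ) * ‖v‖ ^ 2)) (x - y) * g y := by
    intro x
    simp only [← integral_complex_ofReal, ← integral_const_mul, Complex.ofReal_mul,
      gaussianKernel_eq_fourierInv hs, mul_assoc]
  apply Complex.ofReal_injective
  calc ((∫ x, g x * ∫ y, gaussianKernel s x y * g y : ℝ) : ℂ)
    _ = kernelMass d s * ∫ x, starRingEnd ℂ (g x) * ∫ y,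
        𝓕⁻ (fun v : Rd d => Complex.exp (-(Real.pi ^ 2 / s : ℝ) * ‖v‖ ^ 2)) (x - y) * g y := by
      rw [← integral_complex_ofReal, ← integral_const_mul]
      simp only [Complex.ofReal_mul, hinner, Complex.conj_ofReal, mul_left_comm]
    _ = _ := by
      rw [integral_conj_mul_integral_fourierInv_sub_mul hφ hgC, Complex.ofReal_mul,
        ← integral_complex_ofReal]
      simp only [Complex.ofReal_mul, Complex.ofReal_exp, Complex.ofReal_neg, Complex.ofReal_pow,
        fourierReal]

end GaussianEnergy

section TwoSample

variable {Ω : Type*} [MeasurableSpace Ω] {n : ℕ} {P Q : Measure Ω} {b : Ω → ℝ}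

/-- The average of `b` over the sample `x`. -/
noncomputable def empiricalMean (b : Ω → ℝ) (x : Fin n → Ω) : ℝ := (1 / (n : ℝ)) * ∑ i, b (x i)

/-- The law of two independent i.i.d. samples of size `n`, from `P` and from `Q`. -/
noncomputable abbrev twoSampleLaw (n : ℕ) (P Q : Measure Ω) : Measure ((Fin n → Ω) × (Fin n → Ω)) :=
  (Measure.pi fun _ => P).prod (Measure.pi fun _ => Q)

lemma measurable_empiricalMean (hb : Measurable b) :
    Measurable fun x : Fin n → Ω => empiricalMean b x := by
  unfold empiricalMean
  fun_prop

variable [IsProbabilityMeasure P] [IsProbabilityMeasure Q]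

lemma secondMoment_empiricalMean_sub_le (hn : n ≠ 0) (hb : AEStronglyMeasurable b P) :
    secondMoment (fun x : Fin n → Ω => empiricalMean b x - ∫ y, b y ∂P) (Measure.pi fun _ => P)
      ≤ ENNReal.ofReal (1 / n) * secondMoment b P := by
  have hcentre : ∀ x : Fin n → Ω, empiricalMean b x - ∫ y, b y ∂P
      = (1 / (n : ℝ)) * ∑ i, (b (x i) - ∫ y, b y ∂P) := fun x => by
    simp only [empiricalMean, Finset.sum_sub_distrib, Finset.sum_const, Finset.card_univ,
      Fintype.card_fin, nsmul_eq_mul]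
    field_simp
  have hsum := secondMoment_sum_sub_integral_le (ι := Fin n) hb 0
  simp only [sub_zero, Fintype.card_fin] at hsum
  simp only [hcentre]
  rw [secondMoment_const_mul]
  grw [hsum]
  rw [← mul_assoc, ← ENNReal.ofReal_natCast, ← ENNReal.ofReal_mul (by positivity)]
  gcongr
  exact le_of_eq (by field_simp)

lemma secondMoment_empiricalMean_sub_empiricalMean_le (hn : n ≠ 0) (hb : Measurable b) :
    secondMoment (fun w : (Fin n → Ω) × (Fin n → Ω) =>
        empiricalMean b w.1 - empiricalMean b w.2 - (∫ y, b y ∂P - ∫ y, b y ∂Q))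
        (twoSampleLaw n P Q)
      ≤ 2 * (ENNReal.ofReal (1 / n) * (secondMoment b P + secondMoment b Q)) := by
  have hmeas (c : ℝ) : Measurable fun x : Fin n → Ω => empiricalMean b x - c :=
    (measurable_empiricalMean hb).sub_const c
  have hP : secondMoment (fun w : (Fin n → Ω) × (Fin n → Ω) => empiricalMean b w.1 - ∫ y, b y ∂P)
      (twoSampleLaw n P Q) ≤ ENNReal.ofReal (1 / n) * secondMoment b P :=
    (secondMoment_comp measurePreserving_fst (hmeas _)).trans_le
      (secondMoment_empiricalMean_sub_le hn hb.aestronglyMeasurable)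
  have hQ : secondMoment (fun w : (Fin n → Ω) × (Fin n → Ω) => empiricalMean b w.2 - ∫ y, b y ∂Q)
      (twoSampleLaw n P Q) ≤ ENNReal.ofReal (1 / n) * secondMoment b Q :=
    (secondMoment_comp measurePreserving_snd (hmeas _)).trans_le
      (secondMoment_empiricalMean_sub_le hn hb.aestronglyMeasurable)
  simp only [sub_sub_sub_comm (empiricalMean b _)]
  refine (secondMoment_sub_le ((hmeas (∫ y, b y ∂P)).comp measurable_fst).aemeasurable _).trans ?_
  rw [← mul_add, mul_add (ENNReal.ofReal _)]
  exact mul_le_mul' le_rfl (add_le_add hP hQ)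

end TwoSample

section BoundedKernel

variable {Ω : Type*} [MeasurableSpace Ω] {k : Ω → Ω → ℝ}

/-- A bounded measurable symmetric kernel. -/
structure IsBoundedKernel (k : Ω → Ω → ℝ) : Prop where
  measurable_uncurry : Measurable (Function.uncurry k)
  symm : ∀ x y, k x y = k y x
  bounded : ∃ C, ∀ x y, ‖k x y‖ ≤ C

namespace IsBoundedKernel

lemma measurable_comp {Ω' : Type*} [MeasurableSpace Ω'] {f g : Ω' → Ω} (hk : IsBoundedKernel k)
    (hf : Measurable f) (hg : Measurable g) : Measurable fun x => k (f x) (g x) :=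
  hk.measurable_uncurry.comp (hf.prodMk hg)

lemma memLp_two (hk : IsBoundedKernel k) (x : Ω) (ν : Measure Ω) [IsFiniteMeasure ν] :
    MemLp (k x) 2 ν := by
  obtain ⟨C, hC⟩ := hk.bounded
  exact .of_bound (hk.measurable_comp measurable_const measurable_id).aestronglyMeasurable C
    (ae_of_all _ (hC x))

lemma measurable_secondMoment (hk : IsBoundedKernel k) (ν : Measure Ω) [SFinite ν] :
    Measurable fun x => secondMoment (k x) ν := by
  have hmeas := hk.measurable_uncurry
  exact (by fun_prop : Measurable fun z : Ω × Ω =>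
    ENNReal.ofReal (Function.uncurry k z ^ 2)).lintegral_prod_right'

end IsBoundedKernel

/-- The population witness function of the maximum mean discrepancy between `P` and `Q`. -/
noncomputable def meanWitness (k : Ω → Ω → ℝ) (P Q : Measure Ω) (y : Ω) : ℝ :=
  ∫ x, k y x ∂P - ∫ x, k y x ∂Q

/-- The squared maximum mean discrepancy between `P` and `Q`. -/
noncomputable def mmdSq (k : Ω → Ω → ℝ) (P Q : Measure Ω) : ℝ :=
  ∫ y, meanWitness k P Q y ∂P - ∫ y, meanWitness k P Q y ∂Q

lemma IsBoundedKernel.measurable_meanWitness (hk : IsBoundedKernel k) (P Q : Measure Ω) [SFinite P]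
    [SFinite Q] : Measurable (meanWitness k P Q) :=
  (hk.measurable_uncurry.stronglyMeasurable.integral_prod_right (ν := P)).measurable.sub
    (hk.measurable_uncurry.stronglyMeasurable.integral_prod_right (ν := Q)).measurable

end BoundedKernel

section Witness

variable {d n : ℕ} {k : Rd d → Rd d → ℝ}

/-- The two samples, of size `n` each, on which the witness function is built. -/
abbrev WitnessData (d n : ℕ) : Type := (Fin n → Rd d) × (Fin n → Rd d)

namespace IsBoundedKernel

lemma measurable_witness_comp {Ω : Type*} [MeasurableSpace Ω] {F G : Ω → Fin n → Rd d}
    {H : Ω → Rd d} (hk : IsBoundedKernel k) (hF : Measurable F) (hG : Measurable G)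
    (hH : Measurable H) : Measurable fun ω => witness k (F ω) (G ω) (H ω) := by
  have hkF (i : Fin n) : Measurable fun ω => k (F ω i) (H ω) := hk.measurable_comp (by fun_prop) hH
  have hkG (i : Fin n) : Measurable fun ω => k (G ω i) (H ω) := hk.measurable_comp (by fun_prop) hH
  exact ((Finset.measurable_fun_sum _ fun i _ => hkF i).const_mul _).sub
    ((Finset.measurable_fun_sum _ fun i _ => hkG i).const_mul _)

lemma memLp_witness (hk : IsBoundedKernel k) (w : WitnessData d n)
    (ν : Measure (Rd d)) [IsFiniteMeasure ν] : MemLp (witness k w.1 w.2) 2 ν :=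
  ((memLp_finsetSum _ fun i _ => hk.memLp_two (w.1 i) ν).const_mul _).sub
    ((memLp_finsetSum _ fun i _ => hk.memLp_two (w.2 i) ν).const_mul _)

variable (P Q ν : Measure (Rd d)) [IsProbabilityMeasure P] [IsProbabilityMeasure Q]

lemma integral_witness [IsFiniteMeasure ν] (hk : IsBoundedKernel k)
    (w : WitnessData d n) :
    ∫ x, witness k w.1 w.2 x ∂ν
      = empiricalMean (fun y => ∫ x, k y x ∂ν) w.1
        - empiricalMean (fun y => ∫ x, k y x ∂ν) w.2 := by
  have hint (y : Rd d) : Integrable (k y) ν := (hk.memLp_two y ν).integrable one_le_two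
  simp only [witness, empiricalMean]
  rw [integral_sub ((integrable_finsetSum _ fun i _ => hint _).const_mul _)
      ((integrable_finsetSum _ fun i _ => hint _).const_mul _), integral_const_mul,
    integral_const_mul, integral_finsetSum _ fun i _ => hint _,
    integral_finsetSum _ fun i _ => hint _]

lemma integral_witness_sub_integral_witness (hk : IsBoundedKernel k)
    (w : WitnessData d n) :
    ∫ x, witness k w.1 w.2 x ∂P - ∫ x, witness k w.1 w.2 x ∂Q
      = empiricalMean (meanWitness k P Q) w.1 - empiricalMean (meanWitness k P Q) w.2 := by
  rw [hk.integral_witness P w, hk.integral_witness Q w]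
  simp only [empiricalMean, meanWitness, Finset.sum_sub_distrib]
  ring

lemma secondMoment_integral_witness_sub_mmdSq_le (hk : IsBoundedKernel k) (hn : n ≠ 0) :
    secondMoment (fun w : WitnessData d n =>
        ∫ x, witness k w.1 w.2 x ∂P - ∫ x, witness k w.1 w.2 x ∂Q - mmdSq k P Q)
        (twoSampleLaw n P Q)
      ≤ 2 * (ENNReal.ofReal (1 / n) *
          (secondMoment (meanWitness k P Q) P + secondMoment (meanWitness k P Q) Q)) := by
  simp only [hk.integral_witness_sub_integral_witness P Q, mmdSq]
  exact secondMoment_empiricalMean_sub_empiricalMean_le hn (hk.measurable_meanWitness P Q)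

lemma secondMoment_witness_sub_meanWitness_le (hk : IsBoundedKernel k) (hn : n ≠ 0) (x : Rd d) :
    secondMoment (fun w : WitnessData d n =>
        witness k w.1 w.2 x - meanWitness k P Q x) (twoSampleLaw n P Q)
      ≤ 2 * (ENNReal.ofReal (1 / n) * (secondMoment (k x) P + secondMoment (k x) Q)) := by
  have h := secondMoment_empiricalMean_sub_empiricalMean_le (P := P) (Q := Q) hn
    (hk.measurable_comp measurable_const measurable_id : Measurable (k x))
  simpa only [witness, meanWitness, empiricalMean, hk.symm _ x] using h

lemma lintegral_evariance_witness_le [IsProbabilityMeasure ν] (hk : IsBoundedKernel k)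
    (hn : n ≠ 0) :
    ∫⁻ w, evariance (witness k w.1 w.2) ν ∂(twoSampleLaw n P Q)
      ≤ 2 * (2 * (ENNReal.ofReal (1 / n) *
          (∫⁻ x, secondMoment (k x) P ∂ν + ∫⁻ x, secondMoment (k x) Q ∂ν)))
        + 2 * secondMoment (meanWitness k P Q) ν := by
  have ha := hk.measurable_meanWitness P Q
  have hmeas : Measurable fun z : WitnessData d n × Rd d =>
      witness k z.1.1 z.1.2 z.2 - meanWitness k P Q z.2 :=
    (hk.measurable_witness_comp (by fun_prop) (by fun_prop) measurable_snd).sub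
      (ha.comp measurable_snd)
  have hdecomp (w : WitnessData d n) : evariance (witness k w.1 w.2) ν
      ≤ 2 * secondMoment (fun x => witness k w.1 w.2 x - meanWitness k P Q x) ν
        + 2 * secondMoment (meanWitness k P Q) ν := by
    have hw : Measurable fun x => witness k w.1 w.2 x - meanWitness k P Q x :=
      hmeas.comp measurable_prodMk_left
    have hsum := secondMoment_add_le (μ := ν) hw.aemeasurable (meanWitness k P Q)
    have hvar := evariance_le_secondMoment_sub (hk.memLp_witness w ν).1 0
    simp only [sub_zero] at hvar
    exact hvar.trans (by simpa only [sub_add_cancel] using hsum)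
  have hswap : ∫⁻ w, secondMoment (fun x => witness k w.1 w.2 x - meanWitness k P Q x) ν
        ∂(twoSampleLaw n P Q)
      ≤ 2 * (ENNReal.ofReal (1 / n) *
          (∫⁻ x, secondMoment (k x) P ∂ν + ∫⁻ x, secondMoment (k x) Q ∂ν)) := by
    refine (lintegral_lintegral_swap (hmeas.pow_const 2).ennreal_ofReal.aemeasurable).trans_le ?_
    refine (lintegral_mono (hk.secondMoment_witness_sub_meanWitness_le P Q hn)).trans_eq ?_
    rw [lintegral_const_mul' _ _ ENNReal.ofNat_ne_top,
      lintegral_const_mul' _ _ ENNReal.ofReal_ne_top,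
      lintegral_add_left (hk.measurable_secondMoment P)]
  grw [lintegral_mono hdecomp]
  rw [lintegral_add_right _ measurable_const, lintegral_const, measure_univ, mul_one,
    lintegral_const_mul' _ _ ENNReal.ofNat_ne_top]
  grw [hswap]

end IsBoundedKernel

end Witness

section Studentize

lemma le_abs_mul_sqrt_of_studentize_le {a v z : ℝ} (h : studentize a v ≤ z) : a ≤ |z| * √v := by
  unfold studentize at h
  split_ifs at h with hv ha
  · rw [EReal.coe_le_coe_iff, div_le_iff₀ (Real.sqrt_pos.2 hv)] at h
    exact h.trans (by gcongr; exact le_abs_self z)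
  · exact absurd h (EReal.coe_lt_top z).not_ge
  · exact (not_lt.1 ha).trans (by positivity)

lemma ofReal_sq_le_of_studentize_le {a v z γ : ℝ} (hγ : 0 ≤ γ) (h : studentize a v ≤ z) :
    ENNReal.ofReal (γ ^ 2)
      ≤ 2 * (ENNReal.ofReal (z ^ 2) * ENNReal.ofReal v) + 2 * ENNReal.ofReal ((a - γ) ^ 2) := by
  have hγa : γ ≤ |z| * √v + |a - γ| := by
    linarith [le_abs_mul_sqrt_of_studentize_le h, neg_abs_le (a - γ)]
  have hv : ENNReal.ofReal (√v ^ 2) = ENNReal.ofReal v := by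
    rcases le_total 0 v with hv | hv
    · rw [Real.sq_sqrt hv]
    · rw [Real.sqrt_eq_zero_of_nonpos hv, ENNReal.ofReal_of_nonpos hv, zero_pow two_ne_zero,
        ENNReal.ofReal_zero]
  calc ENNReal.ofReal (γ ^ 2) ≤ ENNReal.ofReal ((|z| * √v + |a - γ|) ^ 2) := by gcongr
    _ ≤ 2 * ENNReal.ofReal ((|z| * √v) ^ 2) + 2 * ENNReal.ofReal (|a - γ| ^ 2) :=
      ofReal_add_sq_le _ _
    _ = _ := by rw [mul_pow, sq_abs, sq_abs, ENNReal.ofReal_mul (sq_nonneg z), hv]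

end Studentize

section FittedWitness

variable {d N h : ℕ} {𝒱 : Type*} {k : Rd d → Rd d → ℝ} {u : Regressor d N 𝒱}

/-- `μ̂†` for the witness function built from `p.1`, as a function of all the points entering it. -/
noncomputable def witnessMuHat (k : Rd d → Rd d → ℝ) (u : Regressor d N 𝒱)
    (p : WitnessData d (2 * N) × Sample d N h 𝒱) : ℝ :=
  muHat (witness k p.1.1 p.1.2) (u (witness k p.1.1 p.1.2)) p.2.1 p.2.2

/-- `σ̂†²` for the witness function built from `p.1`, as a function of all the points entering
it. -/
noncomputable def witnessSigmaSq (k : Rd d → Rd d → ℝ) (u : Regressor d N 𝒱)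
    (p : WitnessData d (2 * N) × Sample d N h 𝒱) : ℝ :=
  sigmaSq (witness k p.1.1 p.1.2) (u (witness k p.1.1 p.1.2)) p.2.1 p.2.2

variable [MeasurableSpace 𝒱]

/-- The error `μ̂† - E[f̂(Z) | f̂]`, where `Z` follows the first marginal of `ρ`. -/
noncomputable def muHatError (k : Rd d → Rd d → ℝ) (u : Regressor d N 𝒱) (ρ : Measure (Rd d × 𝒱))
    (p : WitnessData d (2 * N) × Sample d N h 𝒱) : ℝ :=
  witnessMuHat k u p - ∫ x, witness k p.1.1 p.1.2 x ∂ρ.fst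

lemma measurable_fitLabelled_witness (hu : MeasurableRegressor k u) (i : Bool × Fin N) :
    Measurable fun p : WitnessData d (2 * N) × Sample d N h 𝒱 =>
      fitLabelled (u (witness k p.1.1 p.1.2)) p.2.1 i :=
  hu.comp (by fun_prop : Measurable fun p : WitnessData d (2 * N) × Sample d N h 𝒱 =>
    (p.1, (fun i' => p.2.1 (!i.1, i')), (p.2.1 i).2))

lemma measurable_fitUnlabelled_witness (hu : MeasurableRegressor k u) (i : Bool × Fin h) :
    Measurable fun p : WitnessData d (2 * N) × Sample d N h 𝒱 =>
      fitUnlabelled (u (witness k p.1.1 p.1.2)) p.2.1 p.2.2 i :=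
  hu.comp (by fun_prop : Measurable fun p : WitnessData d (2 * N) × Sample d N h 𝒱 =>
    (p.1, (fun i' => p.2.1 (!i.1, i')), p.2.2 i))

lemma measurable_resid_witness (hk : IsBoundedKernel k) (hu : MeasurableRegressor k u)
    (i : Bool × Fin N) : Measurable fun p : WitnessData d (2 * N) × Sample d N h 𝒱 =>
      resid (witness k p.1.1 p.1.2) (u (witness k p.1.1 p.1.2)) p.2.1 i :=
  (hk.measurable_witness_comp (by fun_prop) (by fun_prop) (by fun_prop)).sub
    (measurable_fitLabelled_witness hu i)

lemma measurable_witnessMuHat (hk : IsBoundedKernel k) (hu : MeasurableRegressor k u) :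
    Measurable (witnessMuHat (h := h) k u) := by
  have hresid := measurable_resid_witness (h := h) hk hu
  have hlab := measurable_fitLabelled_witness (h := h) hu
  have hunlab := measurable_fitUnlabelled_witness (h := h) hu
  exact ((Finset.measurable_fun_sum _ fun i _ => hresid i).const_mul _).add
    (((Finset.measurable_fun_sum _ fun i _ => hlab i).add
      (Finset.measurable_fun_sum _ fun i _ => hunlab i)).const_mul _)

lemma measurable_witnessSigmaSq (hk : IsBoundedKernel k) (hu : MeasurableRegressor k u) :
    Measurable (witnessSigmaSq (h := h) k u) := by
  have hresid := measurable_resid_witness (h := h) hk hu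
  have hlab := measurable_fitLabelled_witness (h := h) hu
  have hunlab := measurable_fitUnlabelled_witness (h := h) hu
  refine (Measurable.const_mul (Measurable.sub ?_ ?_) _).add
    (Measurable.const_mul (Measurable.sub ?_ ?_) _)
  · exact (Finset.measurable_fun_sum _ fun i _ => (hresid i).pow_const 2).const_mul _
  · exact ((Finset.measurable_fun_sum _ fun i _ => hresid i).const_mul _).pow_const 2
  · exact ((Finset.measurable_fun_sum _ fun i _ => (hlab i).pow_const 2).add
      (Finset.measurable_fun_sum _ fun i _ => (hunlab i).pow_const 2)).const_mul _
  · exact (((Finset.measurable_fun_sum _ fun i _ => hlab i).add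
      (Finset.measurable_fun_sum _ fun i _ => hunlab i)).const_mul _).pow_const 2

lemma measurable_integral_witness {n : ℕ} (hk : IsBoundedKernel k) (P : Measure (Rd d))
    [SFinite P] : Measurable fun w : WitnessData d n => ∫ x, witness k w.1 w.2 x ∂P := by
  have hmeas : Measurable fun z : WitnessData d n × Rd d => witness k z.1.1 z.1.2 z.2 :=
    hk.measurable_witness_comp (by fun_prop) (by fun_prop) measurable_snd
  exact hmeas.stronglyMeasurable.integral_prod_right'.measurable

lemma measurable_evariance_witness {n : ℕ} (hk : IsBoundedKernel k) (P : Measure (Rd d))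
    [SFinite P] : Measurable fun w : WitnessData d n => evariance (witness k w.1 w.2) P := by
  simp only [evariance_eq_secondMoment]
  have hmeas : Measurable fun z : WitnessData d n × Rd d =>
      witness k z.1.1 z.1.2 z.2 - ∫ x, witness k z.1.1 z.1.2 x ∂P :=
    (hk.measurable_witness_comp (by fun_prop) (by fun_prop) measurable_snd).sub
      ((measurable_integral_witness hk P).comp measurable_fst)
  exact (hmeas.pow_const 2).ennreal_ofReal.lintegral_prod_right'

variable {ν : Measure (WitnessData d (2 * N))} {ρ : Measure (Rd d × 𝒱)} [IsProbabilityMeasure ρ]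

lemma measurable_muHatError (hk : IsBoundedKernel k) (hu : MeasurableRegressor k u) :
    Measurable (muHatError (h := h) k u ρ) :=
  (measurable_witnessMuHat hk hu).sub ((measurable_integral_witness hk ρ.fst).comp measurable_fst)

lemma measurable_regressor_witness (hu : MeasurableRegressor k u) (w : WitnessData d (2 * N)) :
    Measurable fun z : (Fin N → Rd d × 𝒱) × 𝒱 => u (witness k w.1 w.2) z.1 z.2 :=
  hu.comp measurable_prodMk_left

lemma lintegral_mul_mul_residual_add_evariance (hk : IsBoundedKernel k) (u : Regressor d N 𝒱)
    {a b : ℝ≥0∞} (ha : a ≠ ⊤) (hb : b ≠ ⊤) :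
    ∫⁻ w, a * (b * (meanSquaredResidual (witness k w.1 w.2) (u (witness k w.1 w.2)) ρ
        + evariance (witness k w.1 w.2) ρ.fst)) ∂ν
      = a * (b * (residualSecondMoment k u ν ρ + expectedCondVariance k ν ρ)) := by
  rw [lintegral_const_mul' _ _ ha, lintegral_const_mul' _ _ hb,
    lintegral_add_right _ (measurable_evariance_witness hk ρ.fst)]
  rfl

lemma secondMoment_muHatError_le (hN : N ≠ 0) (hk : IsBoundedKernel k)
    (hu : MeasurableRegressor k u) :
    secondMoment (muHatError k u ρ) (ν.prod (sampleLaw N h ρ))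
      ≤ 12 * (ENNReal.ofReal (1 / N) *
          (residualSecondMoment k u ν ρ + expectedCondVariance k ν ρ)) := by
  have hbound (w : WitnessData d (2 * N)) :
      secondMoment (fun x => muHatError (h := h) k u ρ (w, x)) (sampleLaw N h ρ)
        ≤ 12 * (ENNReal.ofReal (1 / N) *
          (meanSquaredResidual (witness k w.1 w.2) (u (witness k w.1 w.2)) ρ
            + evariance (witness k w.1 w.2) ρ.fst)) :=
    secondMoment_muHat_sub_le (f := witness k w.1 w.2) (u := u (witness k w.1 w.2)) (ρ := ρ)
      (h := h) hN
      (hk.measurable_witness_comp measurable_const measurable_const measurable_id)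
      (hk.memLp_witness w ρ.fst) (measurable_regressor_witness hu w)
  rw [secondMoment_prod (measurable_muHatError hk hu)]
  exact (lintegral_mono hbound).trans_eq <| lintegral_mul_mul_residual_add_evariance hk u
    ENNReal.ofNat_ne_top ENNReal.ofReal_ne_top

lemma lintegral_witnessSigmaSq_le (hN : N ≠ 0) (hk : IsBoundedKernel k)
    (hu : MeasurableRegressor k u) :
    ∫⁻ p, ENNReal.ofReal (witnessSigmaSq k u p) ∂(ν.prod (sampleLaw N h ρ))
      ≤ 3 * (ENNReal.ofReal (1 / N) *
          (residualSecondMoment k u ν ρ + expectedCondVariance k ν ρ)) := by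
  have hbound (w : WitnessData d (2 * N)) :
      ∫⁻ x, ENNReal.ofReal (witnessSigmaSq k u (w, x)) ∂sampleLaw N h ρ
        ≤ 3 * (ENNReal.ofReal (1 / N) *
          (meanSquaredResidual (witness k w.1 w.2) (u (witness k w.1 w.2)) ρ
            + evariance (witness k w.1 w.2) ρ.fst)) :=
    lintegral_sigmaSq_le (f := witness k w.1 w.2) (u := u (witness k w.1 w.2)) (ρ := ρ)
      (h := h) hN
      (hk.measurable_witness_comp measurable_const measurable_const measurable_id)
      (measurable_regressor_witness hu w)
  rw [lintegral_prod _ (measurable_witnessSigmaSq hk hu).ennreal_ofReal.aemeasurable]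
  exact (lintegral_mono hbound).trans_eq <| lintegral_mul_mul_residual_add_evariance hk u
    ENNReal.ofNat_ne_top ENNReal.ofReal_ne_top

end FittedWitness

section TestPower

variable {d N h₁ h₂ : ℕ} {𝒱 : Type*} [MeasurableSpace 𝒱] {k : Rd d → Rd d → ℝ}
  {uX uY : Regressor d N 𝒱} {PXV PYW : Measure (Rd d × 𝒱)}

/-- The numerator `μ̂†_X - μ̂†_Y` of the test statistic. -/
noncomputable def meanDifference (k : Rd d → Rd d → ℝ) (uX uY : Regressor d N 𝒱)
    (D : Data d N h₁ h₂ 𝒱) : ℝ :=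
  witnessMuHat k uX (D.1, D.2.1) - witnessMuHat k uY (D.1, D.2.2)

/-- The variance estimate `σ̂†²_X + σ̂†²_Y` in the denominator of the test statistic. -/
noncomputable def varianceSum (k : Rd d → Rd d → ℝ) (uX uY : Regressor d N 𝒱)
    (D : Data d N h₁ h₂ 𝒱) : ℝ :=
  witnessSigmaSq k uX (D.1, D.2.1) + witnessSigmaSq k uY (D.1, D.2.2)

/-- The noise of one sample: the residual second moment plus the expected conditional variance. -/
noncomputable def sampleNoise (k : Rd d → Rd d → ℝ) (u : Regressor d N 𝒱)
    (ν : Measure (WitnessData d (2 * N))) (ρ : Measure (Rd d × 𝒱)) : ℝ≥0∞ :=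
  residualSecondMoment k u ν ρ + expectedCondVariance k ν ρ

lemma meanDifference_sub_mmdSq (D : Data d N h₁ h₂ 𝒱) :
    meanDifference k uX uY D - mmdSq k PXV.fst PYW.fst
      = (∫ x, witness k D.1.1 D.1.2 x ∂PXV.fst - ∫ x, witness k D.1.1 D.1.2 x ∂PYW.fst
          - mmdSq k PXV.fst PYW.fst)
        + (muHatError k uX PXV (D.1, D.2.1) - muHatError k uY PYW (D.1, D.2.2)) := by
  simp only [meanDifference, muHatError]
  ring

variable (PXV PYW) [IsProbabilityMeasure PXV] [IsProbabilityMeasure PYW]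

instance : IsProbabilityMeasure (witnessLaw N PXV PYW) := by unfold witnessLaw; infer_instance

instance : IsProbabilityMeasure (dataLaw N h₁ h₂ PXV PYW) := by unfold dataLaw; infer_instance

lemma measurePreserving_data_witness :
    MeasurePreserving (fun D : Data d N h₁ h₂ 𝒱 => D.1) (dataLaw N h₁ h₂ PXV PYW)
      (witnessLaw N PXV PYW) :=
  measurePreserving_fst (ν := (sampleLaw N h₁ PXV).prod (sampleLaw N h₂ PYW))

lemma measurePreserving_data_left :
    MeasurePreserving (fun D : Data d N h₁ h₂ 𝒱 => (D.1, D.2.1)) (dataLaw N h₁ h₂ PXV PYW)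
      ((witnessLaw N PXV PYW).prod (sampleLaw N h₁ PXV)) :=
  (MeasurePreserving.id (witnessLaw N PXV PYW)).prod
    (measurePreserving_fst (μ := sampleLaw N h₁ PXV) (ν := sampleLaw N h₂ PYW))

lemma measurePreserving_data_right :
    MeasurePreserving (fun D : Data d N h₁ h₂ 𝒱 => (D.1, D.2.2)) (dataLaw N h₁ h₂ PXV PYW)
      ((witnessLaw N PXV PYW).prod (sampleLaw N h₂ PYW)) :=
  (MeasurePreserving.id (witnessLaw N PXV PYW)).prod
    (measurePreserving_snd (μ := sampleLaw N h₁ PXV) (ν := sampleLaw N h₂ PYW))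

variable {PXV PYW}

lemma measurable_meanDifference (hk : IsBoundedKernel k) (huX : MeasurableRegressor k uX)
    (huY : MeasurableRegressor k uY) :
    Measurable (meanDifference (h₁ := h₁) (h₂ := h₂) k uX uY) :=
  ((measurable_witnessMuHat hk huX).comp (by fun_prop)).sub
    ((measurable_witnessMuHat hk huY).comp (by fun_prop))

lemma measurable_varianceSum (hk : IsBoundedKernel k) (huX : MeasurableRegressor k uX)
    (huY : MeasurableRegressor k uY) :
    Measurable (varianceSum (h₁ := h₁) (h₂ := h₂) k uX uY) :=
  ((measurable_witnessSigmaSq hk huX).comp (by fun_prop)).add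
    ((measurable_witnessSigmaSq hk huY).comp (by fun_prop))

lemma lintegral_varianceSum_le (hN : N ≠ 0) (hk : IsBoundedKernel k)
    (huX : MeasurableRegressor k uX) (huY : MeasurableRegressor k uY) :
    ∫⁻ D, ENNReal.ofReal (varianceSum k uX uY D) ∂(dataLaw N h₁ h₂ PXV PYW)
      ≤ 3 * (ENNReal.ofReal (1 / N) * (sampleNoise k uX (witnessLaw N PXV PYW) PXV
          + sampleNoise k uY (witnessLaw N PXV PYW) PYW)) := by
  have hX := (measurable_witnessSigmaSq (h := h₁) hk huX).ennreal_ofReal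
  have hY := (measurable_witnessSigmaSq (h := h₂) hk huY).ennreal_ofReal
  have hπX := measurePreserving_data_left (N := N) (h₁ := h₁) (h₂ := h₂) PXV PYW
  have hπY := measurePreserving_data_right (N := N) (h₁ := h₁) (h₂ := h₂) PXV PYW
  calc ∫⁻ D, ENNReal.ofReal (varianceSum k uX uY D) ∂(dataLaw N h₁ h₂ PXV PYW)
    _ ≤ ∫⁻ D, ENNReal.ofReal (witnessSigmaSq k uX (D.1, D.2.1))
          + ENNReal.ofReal (witnessSigmaSq k uY (D.1, D.2.2)) ∂(dataLaw N h₁ h₂ PXV PYW) :=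
      lintegral_mono fun D => ENNReal.ofReal_add_le
    _ = ∫⁻ p, ENNReal.ofReal (witnessSigmaSq k uX p)
            ∂((witnessLaw N PXV PYW).prod (sampleLaw N h₁ PXV))
          + ∫⁻ p, ENNReal.ofReal (witnessSigmaSq k uY p)
            ∂((witnessLaw N PXV PYW).prod (sampleLaw N h₂ PYW)) := by
      rw [← hπX.lintegral_comp hX, ← hπY.lintegral_comp hY]
      exact lintegral_add_left (hX.comp hπX.measurable) _
    _ ≤ _ := by
      rw [mul_add (ENNReal.ofReal _), mul_add]
      exact add_le_add (lintegral_witnessSigmaSq_le hN hk huX)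
        (lintegral_witnessSigmaSq_le hN hk huY)

lemma secondMoment_meanDifference_sub_mmdSq_le (hN : N ≠ 0) (hk : IsBoundedKernel k)
    (huX : MeasurableRegressor k uX) (huY : MeasurableRegressor k uY) :
    secondMoment (fun D => meanDifference k uX uY D - mmdSq k PXV.fst PYW.fst)
        (dataLaw N h₁ h₂ PXV PYW)
      ≤ ENNReal.ofReal (1 / N) *
        (2 * (secondMoment (meanWitness k PXV.fst PYW.fst) PXV.fst
            + secondMoment (meanWitness k PXV.fst PYW.fst) PYW.fst)
          + 48 * (sampleNoise k uX (witnessLaw N PXV PYW) PXV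
            + sampleNoise k uY (witnessLaw N PXV PYW) PYW)) := by
  have hX := measurable_muHatError (h := h₁) (ρ := PXV) hk huX
  have hY := measurable_muHatError (h := h₂) (ρ := PYW) hk huY
  have hθ : Measurable fun w : WitnessData d (2 * N) => ∫ x, witness k w.1 w.2 x ∂PXV.fst
      - ∫ x, witness k w.1 w.2 x ∂PYW.fst - mmdSq k PXV.fst PYW.fst :=
    ((measurable_integral_witness hk _).sub (measurable_integral_witness hk _)).sub_const _
  have hπ := measurePreserving_data_witness (N := N) (h₁ := h₁) (h₂ := h₂) PXV PYW
  have hπX := measurePreserving_data_left (N := N) (h₁ := h₁) (h₂ := h₂) PXV PYW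
  have hπY := measurePreserving_data_right (N := N) (h₁ := h₁) (h₂ := h₂) PXV PYW
  have hsignal := (secondMoment_comp hπ hθ).trans_le
    (hk.secondMoment_integral_witness_sub_mmdSq_le PXV.fst PYW.fst (by omega))
  have hnoiseX := (secondMoment_comp hπX hX).trans_le (secondMoment_muHatError_le hN hk huX)
  have hnoiseY := (secondMoment_comp hπY hY).trans_le (secondMoment_muHatError_le hN hk huY)
  have hhalf : 2 * ENNReal.ofReal (1 / (2 * N : ℕ)) = ENNReal.ofReal (1 / N) := by
    rw [← ENNReal.ofReal_ofNat 2, ← ENNReal.ofReal_mul (by norm_num)]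
    congr 1
    push_cast
    field_simp
  simp only [meanDifference_sub_mmdSq]
  refine (secondMoment_add_le (hθ.comp hπ.measurable).aemeasurable _).trans ((add_le_add
    (mul_le_mul' le_rfl hsignal) (mul_le_mul' le_rfl ((secondMoment_sub_le
      (hX.comp hπX.measurable).aemeasurable _).trans (add_le_add (mul_le_mul' le_rfl hnoiseX)
        (mul_le_mul' le_rfl hnoiseY))))).trans_eq ?_)
  rw [← mul_assoc 2 (ENNReal.ofReal _), hhalf]
  simp only [sampleNoise]
  ring

lemma ofReal_sq_mmdSq_mul_measure_le (α : ℝ) (hN : N ≠ 0) (hk : IsBoundedKernel k)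
    (huX : MeasurableRegressor k uX) (huY : MeasurableRegressor k uY)
    (hγ : 0 ≤ mmdSq k PXV.fst PYW.fst) :
    ENNReal.ofReal (mmdSq k PXV.fst PYW.fst ^ 2) * dataLaw N h₁ h₂ PXV PYW
        {D | xssStatistic k uX uY D ≤ normalQuantile (1 - α)}
      ≤ ENNReal.ofReal (1 / N) *
        (4 * (secondMoment (meanWitness k PXV.fst PYW.fst) PXV.fst
            + secondMoment (meanWitness k PXV.fst PYW.fst) PYW.fst)
          + (96 + 6 * ENNReal.ofReal (normalQuantile (1 - α) ^ 2)) *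
            (sampleNoise k uX (witnessLaw N PXV PYW) PXV
              + sampleNoise k uY (witnessLaw N PXV PYW) PYW)) := by
  set γ := mmdSq k PXV.fst PYW.fst
  set z := normalQuantile (1 - α)
  let loss (D : Data d N h₁ h₂ 𝒱) : ℝ≥0∞ :=
    2 * (ENNReal.ofReal (z ^ 2) * ENNReal.ofReal (varianceSum k uX uY D))
      + 2 * ENNReal.ofReal ((meanDifference k uX uY D - γ) ^ 2)
  have hvar := (measurable_varianceSum (h₁ := h₁) (h₂ := h₂) hk huX huY).ennreal_ofReal
  have hmean := (((measurable_meanDifference (h₁ := h₁) (h₂ := h₂) hk huX huY).sub_const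
    γ).pow_const 2).ennreal_ofReal
  have hloss : Measurable loss := ((hvar.const_mul _).const_mul 2).add (hmean.const_mul 2)
  have hsubset : {D : Data d N h₁ h₂ 𝒱 | xssStatistic k uX uY D ≤ z}
      ⊆ {D | ENNReal.ofReal (γ ^ 2) ≤ loss D} := fun D hD => ofReal_sq_le_of_studentize_le hγ hD
  grw [hsubset, mul_meas_ge_le_lintegral hloss]
  have hint : ∫⁻ D, loss D ∂(dataLaw N h₁ h₂ PXV PYW)
      = 2 * (ENNReal.ofReal (z ^ 2)
          * ∫⁻ D, ENNReal.ofReal (varianceSum k uX uY D) ∂(dataLaw N h₁ h₂ PXV PYW))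
        + 2 * secondMoment (fun D => meanDifference k uX uY D - γ)
          (dataLaw N h₁ h₂ PXV PYW) := by
    rw [lintegral_add_right _ (hmean.const_mul 2), lintegral_const_mul' _ _ ENNReal.ofNat_ne_top,
      lintegral_const_mul' _ _ ENNReal.ofReal_ne_top,
      lintegral_const_mul' _ _ ENNReal.ofNat_ne_top]
    rfl
  rw [hint]
  grw [lintegral_varianceSum_le hN hk huX huY,
    secondMoment_meanDifference_sub_mmdSq_le hN hk huX huY]
  exact le_of_eq (by ring)

/-- The factor between the noise-to-signal ratio and the bound on the type II error of the test. -/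
noncomputable def errorConst (α : ℝ) (C : ℝ≥0) : ℝ :=
  8 + (C + 1) * (192 + 12 * normalQuantile (1 - α) ^ 2)

lemma errorConst_nonneg (α : ℝ) (C : ℝ≥0) : 0 ≤ errorConst α C := by
  unfold errorConst
  positivity

theorem one_sub_le_xssPower {α V : ℝ} {C : ℝ≥0} (hN : N ≠ 0) (hk : IsBoundedKernel k)
    (huX : MeasurableRegressor k uX) (huY : MeasurableRegressor k uY)
    (hres : ResidualCondition k uX uY C PXV PYW) (hV : 0 ≤ V)
    (hmeanX : secondMoment (meanWitness k PXV.fst PYW.fst) PXV.fst ≤ ENNReal.ofReal V)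
    (hmeanY : secondMoment (meanWitness k PXV.fst PYW.fst) PYW.fst ≤ ENNReal.ofReal V)
    (hvarX : expectedCondVariance k (witnessLaw N PXV PYW) PXV ≤ ENNReal.ofReal V)
    (hvarY : expectedCondVariance k (witnessLaw N PXV PYW) PYW ≤ ENNReal.ofReal V)
    (hγ : 0 < mmdSq k PXV.fst PYW.fst) :
    1 - errorConst α C * (V / N / mmdSq k PXV.fst PYW.fst ^ 2)
      ≤ xssPower h₁ h₂ α k uX uY PXV PYW := by
  set γ := mmdSq k PXV.fst PYW.fst
  set z := normalQuantile (1 - α)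
  have hnoiseX : sampleNoise k uX (witnessLaw N PXV PYW) PXV ≤ (C + 1) * ENNReal.ofReal V := by
    rw [sampleNoise, add_mul, one_mul]
    grw [hres.1, hvarX]
  have hnoiseY : sampleNoise k uY (witnessLaw N PXV PYW) PYW ≤ (C + 1) * ENNReal.ofReal V := by
    rw [sampleNoise, add_mul, one_mul]
    grw [hres.2, hvarY]
  have herror := ofReal_sq_mmdSq_mul_measure_le (h₁ := h₁) (h₂ := h₂) α hN hk huX huY hγ.le
  grw [hmeanX, hmeanY, hnoiseX, hnoiseY] at herror
  have hbound : ENNReal.ofReal (1 / N) * (4 * (ENNReal.ofReal V + ENNReal.ofReal V)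
      + (96 + 6 * ENNReal.ofReal (z ^ 2))
        * ((C + 1) * ENNReal.ofReal V + (C + 1) * ENNReal.ofReal V))
      = ENNReal.ofReal (errorConst α C * (V / N)) := by
    simp (disch := positivity) only [← ENNReal.ofReal_coe_nnreal (p := C), ← ENNReal.ofReal_one,
      ← ENNReal.ofReal_ofNat, ← ENNReal.ofReal_add, ← ENNReal.ofReal_mul]
    congr 1
    simp only [errorConst]
    ring
  have hreal : γ ^ 2 * (dataLaw N h₁ h₂ PXV PYW).real {D | xssStatistic k uX uY D ≤ z}
      ≤ errorConst α C * (V / N) := by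
    have h := ENNReal.toReal_le_of_le_ofReal
      (mul_nonneg (errorConst_nonneg α C) (by positivity)) (herror.trans_eq hbound)
    rwa [ENNReal.toReal_mul, ENNReal.toReal_ofReal (sq_nonneg γ)] at h
  have hcompl : {D : Data d N h₁ h₂ 𝒱 | xssStatistic k uX uY D ≤ z}
      = {D | (z : EReal) < xssStatistic k uX uY D}ᶜ := by
    ext D
    exact (not_lt (α := EReal)).symm
  have hone := measureReal_union_le (μ := dataLaw N h₁ h₂ PXV PYW)
    {D | (z : EReal) < xssStatistic k uX uY D} {D | (z : EReal) < xssStatistic k uX uY D}ᶜ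
  rw [hcompl, mul_comm, ← le_div_iff₀ (pow_pos hγ 2), mul_div_assoc] at hreal
  rw [Set.union_compl_self, probReal_univ] at hone
  exact sub_le_iff_le_add.2 (hone.trans (add_le_add le_rfl hreal))

end TestPower

section CauchySchwarz

variable {α : Type*} [MeasurableSpace α] {μ : Measure α}

lemma sq_lintegral_mul_le {f g : α → ℝ≥0∞} (hf : AEMeasurable f μ) (hg : AEMeasurable g μ) :
    (∫⁻ x, f x * g x ∂μ) ^ 2 ≤ (∫⁻ x, f x ^ 2 ∂μ) * ∫⁻ x, g x ^ 2 ∂μ := by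
  have hsqrt (a : ℝ≥0∞) : (a ^ (1 / 2 : ℝ)) ^ 2 = a := by
    rw [← ENNReal.rpow_mul_natCast]
    norm_num
  have h := pow_le_pow_left' (ENNReal.lintegral_mul_le_Lp_mul_Lq μ .two_two hf hg) 2
  simpa only [Pi.mul_apply, mul_pow, hsqrt, ENNReal.rpow_ofNat] using h

lemma sq_lintegral_le {f : α → ℝ≥0∞} (hf : AEMeasurable f μ) :
    (∫⁻ x, f x ∂μ) ^ 2 ≤ μ Set.univ * ∫⁻ x, f x ^ 2 ∂μ := by
  simpa using sq_lintegral_mul_le (f := fun _ => 1) aemeasurable_const hf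

lemma ofReal_sq_eq_enorm_sq (x : ℝ) : ENNReal.ofReal (x ^ 2) = ‖x‖ₑ ^ 2 := by
  rw [Real.enorm_eq_ofReal_abs, ← ENNReal.ofReal_pow (abs_nonneg x), sq_abs]

lemma secondMoment_eq_lintegral_enorm_sq (f : α → ℝ) :
    secondMoment f μ = ∫⁻ x, ‖f x‖ₑ ^ 2 ∂μ := by
  simp only [secondMoment, ofReal_sq_eq_enorm_sq]

lemma secondMoment_eq_eLpNorm_sq (f : α → ℝ) : secondMoment f μ = eLpNorm f 2 μ ^ 2 := by
  rw [secondMoment_eq_lintegral_enorm_sq]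
  simpa using (eLpNorm_nnreal_pow_eq_lintegral (f := f) (μ := μ) (p := 2) two_ne_zero).symm

lemma le_ofReal_of_sq_le_ofReal_sq {a : ℝ≥0∞} {b : ℝ} (hb : 0 ≤ b)
    (h : a ^ 2 ≤ ENNReal.ofReal (b ^ 2)) : a ≤ ENNReal.ofReal b := by
  rwa [ENNReal.ofReal_pow hb, ENNReal.pow_le_pow_left_iff two_ne_zero] at h

end CauchySchwarz

section GaussianKernel

variable {d : ℕ} {s : ℝ}

lemma gaussianKernel_nonneg (s : ℝ) (x y : Rd d) : 0 ≤ gaussianKernel s x y := (Real.exp_pos _).le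

lemma gaussianKernel_le_one (hs : 0 < s) (x y : Rd d) : gaussianKernel s x y ≤ 1 := by
  rw [gaussianKernel, Real.exp_le_one_iff, neg_mul, neg_nonpos]
  positivity

lemma gaussianKernel_comm (s : ℝ) (x y : Rd d) : gaussianKernel s x y = gaussianKernel s y x := by
  rw [gaussianKernel, gaussianKernel, norm_sub_rev]

lemma continuous_uncurry_gaussianKernel (s : ℝ) :
    Continuous (Function.uncurry (gaussianKernel (d := d) s)) := by
  unfold Function.uncurry gaussianKernel
  fun_prop

lemma isBoundedKernel_gaussianKernel (hs : 0 < s) :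
    IsBoundedKernel (gaussianKernel (d := d) s) where
  measurable_uncurry := (continuous_uncurry_gaussianKernel s).measurable
  symm := gaussianKernel_comm s
  bounded := ⟨1, fun x y => by
    rw [Real.norm_of_nonneg (gaussianKernel_nonneg s x y)]
    exact gaussianKernel_le_one hs x y⟩

lemma lintegral_gaussianKernel (hs : 0 < s) (x : Rd d) :
    ∫⁻ y, ENNReal.ofReal (gaussianKernel s x y) = ENNReal.ofReal (kernelMass d s) := by
  have hint : ∫ y, gaussianKernel s x y = kernelMass d s := by
    have htrans := integral_sub_left_eq_self (fun v : Rd d => Real.exp (-s * ‖v‖ ^ 2)) volume x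
    simp only [gaussianKernel]
    rw [htrans, GaussianFourier.integral_rexp_neg_mul_sq_norm hs, finrank_euclideanSpace_fin,
      kernelMass]
  have hintegrable : Integrable fun y => gaussianKernel s x y :=
    .of_integral_ne_zero (hint ▸ (kernelMass_pos d hs).ne')
  rw [← hint, ofReal_integral_eq_lintegral_ofReal hintegrable
    (ae_of_all _ (gaussianKernel_nonneg s x))]

end GaussianKernel

section Smoothing

variable {d : ℕ} {s : ℝ} {f g : Rd d → ℝ≥0∞}

/-- The integral operator of the Gaussian kernel on `[0, ∞]`-valued functions. -/
noncomputable def gaussianSmoothing (s : ℝ) (g : Rd d → ℝ≥0∞) (x : Rd d) : ℝ≥0∞ :=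
  ∫⁻ y, ENNReal.ofReal (gaussianKernel s x y) * g y

lemma measurable_ofReal_gaussianKernel (s : ℝ) (x : Rd d) :
    Measurable fun y => ENNReal.ofReal (gaussianKernel s x y) :=
  ((continuous_uncurry_gaussianKernel s).comp (by fun_prop : Continuous fun y => (x, y))
    ).measurable.ennreal_ofReal

lemma aemeasurable_gaussianKernel_mul (s : ℝ) (hg : AEMeasurable g) :
    AEMeasurable (Function.uncurry fun x y : Rd d => ENNReal.ofReal (gaussianKernel s x y) * g y)
      (volume.prod volume) :=
  (continuous_uncurry_gaussianKernel s).measurable.ennreal_ofReal.aemeasurable.mul hg.comp_snd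

lemma aemeasurable_gaussianSmoothing (s : ℝ) (hg : AEMeasurable g) :
    AEMeasurable (gaussianSmoothing s g) :=
  (aemeasurable_gaussianKernel_mul s hg).lintegral_prod_right'

lemma gaussianSmoothing_le_lintegral (hs : 0 < s) (g : Rd d → ℝ≥0∞) (x : Rd d) :
    gaussianSmoothing s g x ≤ ∫⁻ y, g y :=
  lintegral_mono fun y => mul_le_of_le_one_left' <|
    ENNReal.ofReal_le_one.2 (gaussianKernel_le_one hs x y)

lemma lintegral_gaussianSmoothing (hs : 0 < s) (hg : AEMeasurable g) :
    ∫⁻ x, gaussianSmoothing s g x = ENNReal.ofReal (kernelMass d s) * ∫⁻ y, g y := by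
  have hmass (y : Rd d) : ∫⁻ x, ENNReal.ofReal (gaussianKernel s x y) * g y
      = ENNReal.ofReal (kernelMass d s) * g y := by
    simp only [gaussianKernel_comm s _ y]
    rw [lintegral_mul_const _ (measurable_ofReal_gaussianKernel s y), lintegral_gaussianKernel hs]
  simp only [gaussianSmoothing]
  rw [lintegral_lintegral_swap (aemeasurable_gaussianKernel_mul s hg), lintegral_congr hmass,
    lintegral_const_mul' _ _ ENNReal.ofReal_ne_top]

lemma sq_gaussianSmoothing_le (hs : 0 < s) (hg : AEMeasurable g) (x : Rd d) :
    gaussianSmoothing s g x ^ 2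
      ≤ ENNReal.ofReal (kernelMass d s) * gaussianSmoothing s (fun y => g y ^ 2) x := by
  have hk := (measurable_ofReal_gaussianKernel s x).aemeasurable (μ := volume)
  have hden (h : Rd d → ℝ≥0∞) (hh : AEMeasurable h) :
      ∫⁻ y, h y ∂volume.withDensity (fun y => ENNReal.ofReal (gaussianKernel s x y))
        = gaussianSmoothing s h x :=
    lintegral_withDensity_eq_lintegral_mul₀ hk hh
  have h := sq_lintegral_le (hg.mono_ac (withDensity_absolutelyContinuous volume
    fun y => ENNReal.ofReal (gaussianKernel s x y)))
  rwa [hden g hg, hden _ (hg.pow_const 2), withDensity_apply _ .univ, Measure.restrict_univ,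
    lintegral_gaussianKernel hs] at h

lemma lintegral_gaussianSmoothing_sq_le (hs : 0 < s) (hg : AEMeasurable g) :
    ∫⁻ x, gaussianSmoothing s g x ^ 2
      ≤ ENNReal.ofReal (kernelMass d s) ^ 2 * ∫⁻ y, g y ^ 2 := by
  refine (lintegral_mono (sq_gaussianSmoothing_le hs hg)).trans_eq ?_
  rw [lintegral_const_mul' _ _ ENNReal.ofReal_ne_top,
    lintegral_gaussianSmoothing hs (hg.pow_const 2), sq, mul_assoc]

lemma sq_lintegral_mul_gaussianSmoothing_le (hs : 0 < s) (hf : AEMeasurable f)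
    (hg : AEMeasurable g) :
    (∫⁻ x, f x * gaussianSmoothing s g x) ^ 2
      ≤ (∫⁻ x, f x ^ 2) * (ENNReal.ofReal (kernelMass d s) ^ 2 * ∫⁻ y, g y ^ 2) :=
  (sq_lintegral_mul_le hf (aemeasurable_gaussianSmoothing s hg)).trans <|
    mul_le_mul' le_rfl (lintegral_gaussianSmoothing_sq_le hs hg)

lemma sq_lintegral_mul_gaussianSmoothing_sq_le (hs : 0 < s) (hf : AEMeasurable f)
    (hg : AEMeasurable g) :
    (∫⁻ x, f x * gaussianSmoothing s g x ^ 2) ^ 2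
      ≤ (∫⁻ x, f x ^ 2) * (ENNReal.ofReal (kernelMass d s) ^ 3 * (∫⁻ y, g y ^ 2) ^ 2) := by
  set c := ENNReal.ofReal (kernelMass d s)
  have hTg := aemeasurable_gaussianSmoothing s hg
  have hsup (x : Rd d) : gaussianSmoothing s g x ^ 2 ≤ c * ∫⁻ y, g y ^ 2 :=
    (sq_gaussianSmoothing_le hs hg x).trans <|
      mul_le_mul' le_rfl (gaussianSmoothing_le_lintegral hs _ x)
  have hfourth : ∫⁻ x, (gaussianSmoothing s g x ^ 2) ^ 2
      ≤ (c * ∫⁻ y, g y ^ 2) * (c ^ 2 * ∫⁻ y, g y ^ 2) := by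
    calc ∫⁻ x, (gaussianSmoothing s g x ^ 2) ^ 2
      _ ≤ ∫⁻ x, (c * ∫⁻ y, g y ^ 2) * gaussianSmoothing s g x ^ 2 :=
        lintegral_mono fun x => (sq _).trans_le (mul_le_mul' (hsup x) le_rfl)
      _ = (c * ∫⁻ y, g y ^ 2) * ∫⁻ x, gaussianSmoothing s g x ^ 2 :=
        lintegral_const_mul'' _ (hTg.pow_const 2)
      _ ≤ _ := mul_le_mul' le_rfl (lintegral_gaussianSmoothing_sq_le hs hg)
  grw [sq_lintegral_mul_le hf (hTg.pow_const 2), hfourth]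
  exact le_of_eq (by ring)

end Smoothing

section Density

variable {d : ℕ} {s : ℝ} {P Q R : Measure (Rd d)} {p q r : Rd d → ℝ}

/-- `p` is a density of `P` with respect to Lebesgue measure: it is nonnegative everywhere and
integrable. -/
structure IsDensity (p : Rd d → ℝ) (P : Measure (Rd d)) : Prop where
  integrable : Integrable p
  nonneg : ∀ x, 0 ≤ p x
  eq_withDensity : P = volume.withDensity fun x => ENNReal.ofReal (p x)

namespace IsDensity

lemma isFiniteMeasure (hp : IsDensity p P) : IsFiniteMeasure P :=
  hp.eq_withDensity ▸ isFiniteMeasure_withDensity_ofReal hp.integrable.2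

lemma enorm_eq (hp : IsDensity p P) (x : Rd d) : ‖p x‖ₑ = ENNReal.ofReal (p x) :=
  Real.enorm_of_nonneg (hp.nonneg x)

lemma integral_eq (hp : IsDensity p P) (F : Rd d → ℝ) : ∫ x, F x ∂P = ∫ x, p x * F x := by
  rw [hp.eq_withDensity, integral_withDensity_eq_integral_toReal_smul₀
    hp.integrable.aemeasurable.ennreal_ofReal (ae_of_all _ fun _ => ENNReal.ofReal_lt_top)]
  simp only [ENNReal.toReal_ofReal (hp.nonneg _), smul_eq_mul]

lemma lintegral_eq (hp : IsDensity p P) {F : Rd d → ℝ≥0∞} (hF : Measurable F) :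
    ∫⁻ x, F x ∂P = ∫⁻ x, ‖p x‖ₑ * F x := by
  rw [hp.eq_withDensity, lintegral_withDensity_eq_lintegral_mul₀
    hp.integrable.aemeasurable.ennreal_ofReal hF.aemeasurable]
  simp only [hp.enorm_eq, Pi.mul_apply]

lemma meanWitness_eq (hp : IsDensity p P) (hq : IsDensity q Q) (hs : 0 < s) (y : Rd d) :
    meanWitness (gaussianKernel s) P Q y = ∫ x, gaussianKernel s y x * (p - q) x := by
  have hk := isBoundedKernel_gaussianKernel (d := d) hs
  obtain ⟨C, hC⟩ := hk.bounded
  have hint {h : Rd d → ℝ} (hh : Integrable h) : Integrable fun x => h x * gaussianKernel s y x :=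
    hh.mul_bdd (hk.measurable_comp measurable_const measurable_id').aestronglyMeasurable
      (ae_of_all _ (hC y))
  rw [meanWitness, hp.integral_eq, hq.integral_eq,
    ← integral_sub (hint hp.integrable) (hint hq.integrable)]
  simp only [← sub_mul, Pi.sub_apply, mul_comm]

lemma mmdSq_eq (hp : IsDensity p P) (hq : IsDensity q Q) (hs : 0 < s) :
    mmdSq (gaussianKernel s) P Q = ∫ x, (p - q) x * ∫ y, gaussianKernel s x y * (p - q) y := by
  have := hp.isFiniteMeasure
  have := hq.isFiniteMeasure
  have hmeas := ((isBoundedKernel_gaussianKernel hs).measurable_meanWitness P Q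
    ).aestronglyMeasurable (μ := volume)
  have hbound (y : Rd d) : ‖meanWitness (gaussianKernel s) P Q y‖ ≤ ∫ x, ‖(p - q) x‖ := by
    rw [hp.meanWitness_eq hq hs]
    refine norm_integral_le_of_norm_le (hp.integrable.sub hq.integrable).norm
      (ae_of_all _ fun x => ?_)
    rw [norm_mul, Real.norm_of_nonneg (gaussianKernel_nonneg s y x)]
    exact mul_le_of_le_one_left (norm_nonneg _) (gaussianKernel_le_one hs y x)
  rw [mmdSq, hp.integral_eq, hq.integral_eq, ← integral_sub
    (hp.integrable.mul_bdd hmeas (ae_of_all _ hbound))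
    (hq.integrable.mul_bdd hmeas (ae_of_all _ hbound))]
  simp only [← sub_mul, hp.meanWitness_eq hq hs, Pi.sub_apply]

lemma enorm_meanWitness_le (hp : IsDensity p P) (hq : IsDensity q Q) (hs : 0 < s) (y : Rd d) :
    ‖meanWitness (gaussianKernel s) P Q y‖ₑ ≤ gaussianSmoothing s (fun x => ‖(p - q) x‖ₑ) y := by
  rw [hp.meanWitness_eq hq hs]
  refine (enorm_integral_le_lintegral_enorm _).trans_eq (lintegral_congr fun x => ?_)
  rw [enorm_mul, Real.enorm_of_nonneg (gaussianKernel_nonneg s y x)]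

lemma sq_secondMoment_meanWitness_le (hp : IsDensity p P) (hq : IsDensity q Q)
    (hr : IsDensity r R) (hs : 0 < s) :
    secondMoment (meanWitness (gaussianKernel s) P Q) R ^ 2
      ≤ secondMoment r volume
        * (ENNReal.ofReal (kernelMass d s) ^ 3 * secondMoment (p - q) volume ^ 2) := by
  have := hp.isFiniteMeasure
  have := hq.isFiniteMeasure
  have hmeas := (isBoundedKernel_gaussianKernel hs).measurable_meanWitness P Q
  simp only [secondMoment_eq_lintegral_enorm_sq]
  rw [hr.lintegral_eq (by fun_prop)]
  grw [← sq_lintegral_mul_gaussianSmoothing_sq_le hs hr.integrable.aemeasurable.enorm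
    (hp.integrable.sub hq.integrable).aemeasurable.enorm]
  gcongr
  exact hp.enorm_meanWitness_le hq hs _

lemma secondMoment_gaussianKernel_le (hq : IsDensity q Q) (hs : 0 < s) (x : Rd d) :
    secondMoment (gaussianKernel s x) Q ≤ gaussianSmoothing s (fun y => ‖q y‖ₑ) x := by
  have hmeas := (isBoundedKernel_gaussianKernel hs).measurable_comp
    (measurable_const (a := x)) measurable_id'
  rw [secondMoment, hq.lintegral_eq (hmeas.pow_const 2).ennreal_ofReal]
  refine lintegral_mono fun y => (mul_comm _ _).trans_le (mul_le_mul' ?_ le_rfl)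
  exact ENNReal.ofReal_le_ofReal (pow_le_of_le_one (gaussianKernel_nonneg s x y)
    (gaussianKernel_le_one hs x y) two_ne_zero)

lemma sq_lintegral_secondMoment_gaussianKernel_le (hp : IsDensity p P) (hq : IsDensity q Q)
    (hs : 0 < s) :
    (∫⁻ x, secondMoment (gaussianKernel s x) Q ∂P) ^ 2
      ≤ secondMoment p volume
        * (ENNReal.ofReal (kernelMass d s) ^ 2 * secondMoment q volume) := by
  have := hq.isFiniteMeasure
  rw [hp.lintegral_eq ((isBoundedKernel_gaussianKernel hs).measurable_secondMoment Q)]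
  simp only [secondMoment_eq_lintegral_enorm_sq p, secondMoment_eq_lintegral_enorm_sq q]
  grw [← sq_lintegral_mul_gaussianSmoothing_le hs hp.integrable.aemeasurable.enorm
    hq.integrable.aemeasurable.enorm]
  gcongr
  exact hq.secondMoment_gaussianKernel_le hs _

lemma le_mmdSq {β : ℝ} (hp : IsDensity p P) (hq : IsDensity q Q) (hβ : 0 ≤ β) (hs : 0 < s)
    (henergy : sobolevEnergy β (p - q) ≠ ⊤) :
    kernelMass d s * (Real.exp (-Real.pi ^ 2) * ((secondMoment (p - q) volume).toReal
        - s ^ (-β) * (sobolevEnergy β (p - q)).toReal))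
      ≤ mmdSq (gaussianKernel s) P Q := by
  have hg := hp.integrable.sub hq.integrable
  have hfin : ∫⁻ ω, ENNReal.ofReal (‖fourierReal (p - q) ω‖ ^ 2) ≠ ⊤ :=
    ne_top_of_le_ne_top henergy (lintegral_fourierReal_sq_le_sobolevEnergy hβ _)
  set W : ℝ≥0∞ := ∫⁻ ω, ENNReal.ofReal
    (Real.exp (-(Real.pi ^ 2 / s) * ‖ω‖ ^ 2) * ‖fourierReal (p - q) ω‖ ^ 2) with hW
  have hWfin : W ≠ ⊤ := ne_top_of_le_ne_top hfin <| lintegral_mono fun ω =>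
    ENNReal.ofReal_le_ofReal <| mul_le_of_le_one_left (sq_nonneg _) <| Real.exp_le_one_iff.2 <| by
      rw [neg_mul, neg_nonpos]
      positivity
  have hmmd : mmdSq (gaussianKernel s) P Q = kernelMass d s * W.toReal := by
    have hcont := continuous_fourierReal hg
    rw [hp.mmdSq_eq hq hs, integral_mul_integral_gaussianKernel_mul hs hg, hW,
      integral_eq_lintegral_of_nonneg_ae (ae_of_all _ fun ω => by positivity)
        (by fun_prop : Continuous _).aestronglyMeasurable]
  have hsmooth := ENNReal.toReal_mono (ENNReal.add_ne_top.2
    ⟨ENNReal.mul_ne_top ENNReal.ofReal_ne_top hWfin, ENNReal.mul_ne_top ENNReal.ofReal_ne_top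
      henergy⟩) (lintegral_fourierReal_sq_le hβ hs hg)
  rw [← secondMoment_eq_lintegral_fourierReal hg hfin, ENNReal.toReal_add
    (ENNReal.mul_ne_top ENNReal.ofReal_ne_top hWfin)
    (ENNReal.mul_ne_top ENNReal.ofReal_ne_top henergy), ENNReal.toReal_mul, ENNReal.toReal_mul,
    ENNReal.toReal_ofReal (by positivity), ENNReal.toReal_ofReal (by positivity),
    ← sub_le_iff_le_add] at hsmooth
  rw [hmmd, Real.exp_neg]
  refine mul_le_mul_of_nonneg_left ?_ (kernelMass_pos d hs).le
  rwa [inv_mul_le_iff₀ (Real.exp_pos _)]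

end IsDensity

end Density

section SobolevBall

variable {d : ℕ} {β M : ℝ} {p q : Rd d → ℝ}

lemma sobolevEnergy_lt_of_mem_sobolevBall (hp : p ∈ sobolevBall d β M) :
    sobolevEnergy β p < ENNReal.ofReal M := hp.2.2

lemma pos_of_mem_sobolevBall (hp : p ∈ sobolevBall d β M) : 0 < M :=
  ENNReal.ofReal_pos.1 (bot_le.trans_lt (sobolevEnergy_lt_of_mem_sobolevBall hp))

lemma secondMoment_le_of_mem_sobolevBall (hβ : 0 ≤ β) (hp : p ∈ sobolevBall d β M) :
    secondMoment p volume ≤ ENNReal.ofReal M := by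
  have henergy := sobolevEnergy_lt_of_mem_sobolevBall hp
  have hfourier := lintegral_fourierReal_sq_le_sobolevEnergy hβ p
  rw [secondMoment_eq_lintegral_fourierReal hp.1 (hfourier.trans_lt henergy.lt_top).ne]
  exact hfourier.trans henergy.le

lemma sobolevEnergy_sub_le_of_mem_sobolevBall (hp : p ∈ sobolevBall d β M)
    (hq : q ∈ sobolevBall d β M) : sobolevEnergy β (p - q) ≤ ENNReal.ofReal (4 * M) := by
  grw [sobolevEnergy_sub_le hp.1 hq.1, (sobolevEnergy_lt_of_mem_sobolevBall hp).le,
    (sobolevEnergy_lt_of_mem_sobolevBall hq).le]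
  rw [← add_mul, ENNReal.ofReal_mul zero_le_four, ENNReal.ofReal_ofNat]
  norm_num

lemma secondMoment_sub_ne_top_of_mem_sobolevBall (hβ : 0 ≤ β) (hp : p ∈ sobolevBall d β M)
    (hq : q ∈ sobolevBall d β M) : secondMoment (p - q) volume ≠ ⊤ := by
  have hp2 := (secondMoment_le_of_mem_sobolevBall hβ hp).trans_lt ENNReal.ofReal_lt_top
  have hq2 := (secondMoment_le_of_mem_sobolevBall hβ hq).trans_lt ENNReal.ofReal_lt_top
  exact ne_top_of_le_ne_top (by finiteness)
    (secondMoment_sub_le hp.1.aemeasurable q)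

end SobolevBall

section SmoothAlternatives

variable {d N : ℕ} {𝒱 : Type*} [MeasurableSpace 𝒱] {s β M E : ℝ} {P Q R : Measure (Rd d)}
  {p q r : Rd d → ℝ}

namespace IsDensity

lemma secondMoment_meanWitness_le (hp : IsDensity p P) (hq : IsDensity q Q) (hr : IsDensity r R)
    (hs : 0 < s) (hM : 0 ≤ M) (hE : 0 ≤ E) (hrM : secondMoment r volume ≤ ENNReal.ofReal M)
    (hpq : secondMoment (p - q) volume ≤ ENNReal.ofReal E) :
    secondMoment (meanWitness (gaussianKernel s) P Q) R
      ≤ ENNReal.ofReal (√(kernelMass d s) * kernelMass d s * √M * E) := by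
  have hc := kernelMass_pos d hs
  refine le_ofReal_of_sq_le_ofReal_sq (by positivity)
    ((hp.sq_secondMoment_meanWitness_le hq hr hs).trans ?_)
  grw [hrM, hpq]
  simp (disch := positivity) only [← ENNReal.ofReal_mul, ← ENNReal.ofReal_pow, mul_pow,
    Real.sq_sqrt]
  exact ENNReal.ofReal_le_ofReal (le_of_eq (by ring))

lemma lintegral_secondMoment_gaussianKernel_le (hp : IsDensity p P) (hq : IsDensity q Q)
    (hs : 0 < s) (hM : 0 ≤ M) (hpM : secondMoment p volume ≤ ENNReal.ofReal M)
    (hqM : secondMoment q volume ≤ ENNReal.ofReal M) :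
    ∫⁻ x, secondMoment (gaussianKernel s x) Q ∂P ≤ ENNReal.ofReal (kernelMass d s * M) := by
  have hc := kernelMass_pos d hs
  refine le_ofReal_of_sq_le_ofReal_sq (by positivity)
    ((hp.sq_lintegral_secondMoment_gaussianKernel_le hq hs).trans ?_)
  grw [hpM, hqM]
  simp (disch := positivity) only [← ENNReal.ofReal_mul, ← ENNReal.ofReal_pow]
  exact ENNReal.ofReal_le_ofReal (le_of_eq (by ring))

lemma le_mmdSq_of_bias_le (hp : IsDensity p P) (hq : IsDensity q Q) (hβ : 0 ≤ β) (hs : 0 < s)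
    (hM : 0 ≤ M) (hE : secondMoment (p - q) volume = ENNReal.ofReal E) (hE0 : 0 ≤ E)
    (henergy : sobolevEnergy β (p - q) ≤ ENNReal.ofReal M) (hbias : s ^ (-β) * M ≤ E / 2) :
    kernelMass d s * (Real.exp (-Real.pi ^ 2) / 2 * E) ≤ mmdSq (gaussianKernel s) P Q := by
  refine le_trans ?_ (hp.le_mmdSq hq hβ hs (ne_top_of_le_ne_top ENNReal.ofReal_ne_top henergy))
  rw [hE, ENNReal.toReal_ofReal hE0, div_mul_eq_mul_div, mul_div_assoc]
  have := kernelMass_pos d hs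
  gcongr
  grw [ENNReal.toReal_le_of_le_ofReal hM henergy]
  linarith

end IsDensity

lemma expectedCondVariance_le {k : Rd d → Rd d → ℝ} {A B : ℝ} {ρ PXV PYW : Measure (Rd d × 𝒱)}
    [IsProbabilityMeasure ρ] [IsProbabilityMeasure PXV] [IsProbabilityMeasure PYW]
    (hN : N ≠ 0) (hk : IsBoundedKernel k) (hA0 : 0 ≤ A) (hB0 : 0 ≤ B)
    (hA : secondMoment (meanWitness k PXV.fst PYW.fst) ρ.fst ≤ ENNReal.ofReal A)
    (hX : ∫⁻ x, secondMoment (k x) PXV.fst ∂ρ.fst ≤ ENNReal.ofReal B)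
    (hY : ∫⁻ x, secondMoment (k x) PYW.fst ∂ρ.fst ≤ ENNReal.ofReal B) :
    expectedCondVariance k (witnessLaw N PXV PYW) ρ ≤ ENNReal.ofReal (2 * A + 4 * B / N) := by
  refine (hk.lintegral_evariance_witness_le PXV.fst PYW.fst ρ.fst
    (mul_ne_zero two_ne_zero hN)).trans ?_
  grw [hA, hX, hY]
  simp (disch := positivity) only [← ENNReal.ofReal_add, ← ENNReal.ofReal_mul,
    ← ENNReal.ofReal_ofNat]
  refine ENNReal.ofReal_le_ofReal (le_of_eq ?_)
  push_cast
  field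

/-- The order of the noise of the estimated discrepancy relative to the discrepancy, when the test
uses samples of size `n` and the densities, with second moments at most `M`, have squared
`L²`-distance `E`. -/
noncomputable def noiseLevel (d n : ℕ) (s M E : ℝ) : ℝ :=
  √M / (n * √(kernelMass d s) * E)

lemma noiseLevel_nonneg (d n : ℕ) (s M : ℝ) (hE : 0 ≤ E) : 0 ≤ noiseLevel d n s M E := by
  unfold noiseLevel
  positivity

lemma noiseLevel_anti {E' : ℝ} (hN : N ≠ 0) (hs : 0 < s) (hE : 0 < E) (hEE' : E ≤ E') :
    noiseLevel d N s M E' ≤ noiseLevel d N s M E := by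
  have := kernelMass_pos d hs
  unfold noiseLevel
  gcongr

lemma variance_div_sq_signal_eq {κ : ℝ} (hN : N ≠ 0) (hs : 0 < s) (hM : 0 ≤ M) (hE : E ≠ 0)
    (hκ : κ ≠ 0) :
    (2 * (√(kernelMass d s) * kernelMass d s * √M * E) + 4 * (kernelMass d s * M) / N) / N
        / (kernelMass d s * (κ * E)) ^ 2
      = (4 * noiseLevel d (2 * N) s M E + 16 * noiseLevel d (2 * N) s M E ^ 2) / κ ^ 2 := by
  have hc := kernelMass_pos d hs
  have hsqrt_c := Real.sq_sqrt hc.le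
  have hsqrt_M := Real.sq_sqrt hM
  have hpos := Real.sqrt_pos.2 hc
  unfold noiseLevel
  generalize √(kernelMass d s) = x at *
  generalize √M = y at *
  rw [← hsqrt_c, ← hsqrt_M]
  push_cast
  field_simp
  ring

lemma one_sub_le_xssPower_of_isDensity {h₁ h₂ : ℕ} {α κ : ℝ} {uX uY : Regressor d N 𝒱}
    {PXV PYW : Measure (Rd d × 𝒱)} [IsProbabilityMeasure PXV] [IsProbabilityMeasure PYW]
    (hpX : IsDensity p PXV.fst) (hqY : IsDensity q PYW.fst)
    (hpM : secondMoment p volume ≤ ENNReal.ofReal M)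
    (hqM : secondMoment q volume ≤ ENNReal.ofReal M) (hM : 0 ≤ M)
    (hpq : secondMoment (p - q) volume ≤ ENNReal.ofReal E) (hE : 0 < E)
    (hs : 0 < s) (hN : N ≠ 0) (huX : MeasurableRegressor (gaussianKernel s) uX)
    (huY : MeasurableRegressor (gaussianKernel s) uY) {C : ℝ≥0}
    (hres : ResidualCondition (gaussianKernel s) uX uY C PXV PYW) (hκ : 0 < κ)
    (hsignal : kernelMass d s * (κ * E) ≤ mmdSq (gaussianKernel s) PXV.fst PYW.fst) :
    1 - errorConst α C * ((4 * noiseLevel d (2 * N) s M E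
        + 16 * noiseLevel d (2 * N) s M E ^ 2) / κ ^ 2)
      ≤ xssPower h₁ h₂ α (gaussianKernel s) uX uY PXV PYW := by
  have hk := isBoundedKernel_gaussianKernel (d := d) hs
  have hc := kernelMass_pos d hs
  set A := √(kernelMass d s) * kernelMass d s * √M * E
  set B := kernelMass d s * M
  have hA0 : 0 ≤ A := by positivity
  have hB0 : 0 ≤ B := by positivity
  have hmeanX := hpX.secondMoment_meanWitness_le hqY hpX hs hM hE.le hpM hpq
  have hmeanY := hpX.secondMoment_meanWitness_le hqY hqY hs hM hE.le hqM hpq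
  have hvarX := expectedCondVariance_le hN hk hA0 hB0 hmeanX
    (hpX.lintegral_secondMoment_gaussianKernel_le hpX hs hM hpM hpM)
    (hpX.lintegral_secondMoment_gaussianKernel_le hqY hs hM hpM hqM)
  have hvarY := expectedCondVariance_le hN hk hA0 hB0 hmeanY
    (hqY.lintegral_secondMoment_gaussianKernel_le hpX hs hM hqM hpM)
    (hqY.lintegral_secondMoment_gaussianKernel_le hqY hs hM hqM hqM)
  have hAV : A ≤ 2 * A + 4 * B / N := by
    have : 0 ≤ 4 * B / N := by positivity
    linarith
  have hpower := one_sub_le_xssPower (h₁ := h₁) (h₂ := h₂) (α := α) hN hk huX huY hres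
    (hA0.trans hAV) (hmeanX.trans (ENNReal.ofReal_le_ofReal hAV))
    (hmeanY.trans (ENNReal.ofReal_le_ofReal hAV)) hvarX hvarY
    ((by positivity : 0 < kernelMass d s * (κ * E)).trans_le hsignal)
  refine le_trans ?_ hpower
  have := errorConst_nonneg α C
  grw [← variance_div_sq_signal_eq hN hs hM hE.ne' hκ.ne', ← hsignal]

theorem one_sub_le_xssPower_of_smoothAlternatives {h₁ h₂ : ℕ} {α δ : ℝ} {uX uY : Regressor d N 𝒱}
    {PXV PYW : Measure (Rd d × 𝒱)} [IsProbabilityMeasure PXV] [IsProbabilityMeasure PYW]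
    (hs : 0 < s) (hβ : 0 ≤ β) (hN : N ≠ 0) (huX : MeasurableRegressor (gaussianKernel s) uX)
    (huY : MeasurableRegressor (gaussianKernel s) uY) {C : ℝ≥0}
    (hres : ResidualCondition (gaussianKernel s) uX uY C PXV PYW) (hδ : 0 < δ)
    (halt : (PXV.fst, PYW.fst) ∈ smoothAlternatives d β M δ)
    (hbias : s ^ (-β) * (4 * M) ≤ δ ^ 2 / 2) :
    1 - errorConst α C * ((4 * noiseLevel d (2 * N) s M (δ ^ 2)
        + 16 * noiseLevel d (2 * N) s M (δ ^ 2) ^ 2) / (Real.exp (-Real.pi ^ 2) / 2) ^ 2)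
      ≤ xssPower h₁ h₂ α (gaussianKernel s) uX uY PXV PYW := by
  obtain ⟨p, hp, q, hq, hp0, hq0, hX, hY, hsep⟩ := halt
  have hpX : IsDensity p PXV.fst := ⟨hp.1, hp0, hX⟩
  have hqY : IsDensity q PYW.fst := ⟨hq.1, hq0, hY⟩
  have hM := (pos_of_mem_sobolevBall hp).le
  obtain ⟨E, hE⟩ : ∃ E, secondMoment (p - q) volume = ENNReal.ofReal E :=
    ⟨_, (ENNReal.ofReal_toReal (secondMoment_sub_ne_top_of_mem_sobolevBall hβ hp hq)).symm⟩
  have hδE : δ ^ 2 ≤ E := by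
    refine (ENNReal.ofReal_le_ofReal_iff'.1 ?_).resolve_right (by positivity : 0 < δ ^ 2).not_ge
    rw [← hE, secondMoment_eq_eLpNorm_sq, ENNReal.ofReal_pow hδ.le]
    gcongr
  have hE0 : 0 < E := (by positivity : 0 < δ ^ 2).trans_le hδE
  have hsignal := hpX.le_mmdSq_of_bias_le hqY hβ hs (by positivity) hE hE0.le
    (sobolevEnergy_sub_le_of_mem_sobolevBall hp hq) (by linarith)
  have hpower := one_sub_le_xssPower_of_isDensity (h₁ := h₁) (h₂ := h₂) (α := α) hpX hqY
    (secondMoment_le_of_mem_sobolevBall hβ hp) (secondMoment_le_of_mem_sobolevBall hβ hq) hM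
    hE.le hE0 hs hN huX huY hres (by positivity) hsignal
  refine le_trans ?_ hpower
  have := errorConst_nonneg α C
  have := noiseLevel_nonneg d (2 * N) s M hE0.le
  grw [noiseLevel_anti (mul_ne_zero two_ne_zero hN) hs (by positivity) hδE]

lemma worstCasePower_le_one (h₁ h₂ : ℕ) (α : ℝ) (k : Rd d → Rd d → ℝ) (uX uY : Regressor d N 𝒱)
    (𝒬 : Set (ProbabilityMeasure (Rd d × 𝒱) × ProbabilityMeasure (Rd d × 𝒱))) :
    worstCasePower h₁ h₂ α k uX uY 𝒬 ≤ 1 := by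
  refine csInf_le ⟨0, ?_⟩ (Set.mem_insert _ _)
  rintro b (rfl | ⟨q, -, rfl⟩)
  · exact zero_le_one
  · exact measureReal_nonneg

lemma le_worstCasePower {h₁ h₂ : ℕ} {α : ℝ} {k : Rd d → Rd d → ℝ} {uX uY : Regressor d N 𝒱}
    {𝒬 : Set (ProbabilityMeasure (Rd d × 𝒱) × ProbabilityMeasure (Rd d × 𝒱))} {a : ℝ}
    (ha : a ≤ 1) (h : ∀ q ∈ 𝒬, a ≤ xssPower h₁ h₂ α k uX uY (q.1 : Measure (Rd d × 𝒱)) q.2) :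
    a ≤ worstCasePower h₁ h₂ α k uX uY 𝒬 := by
  refine le_csInf (Set.insert_nonempty _ _) ?_
  rintro b (rfl | ⟨q, hq, rfl⟩)
  · exact ha
  · exact h q hq

end SmoothAlternatives

section Rates

variable {d : ℕ} {β : ℝ} {s Δ : ℕ → ℝ}

lemma isTheta_rpow_mul {a : ℝ} (hs_pos : ∀ n, 0 < s n)
    (hs : s =Θ[atTop] fun n : ℕ => (n : ℝ) ^ a) (b : ℝ) :
    (fun n => s n ^ b) =Θ[atTop] fun n : ℕ => (n : ℝ) ^ (a * b) := by
  simp only [Real.rpow_mul (Nat.cast_nonneg _)]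
  exact hs.rpow (.of_forall fun n => (hs_pos n).le) (.of_forall fun n => by positivity)

lemma rpow_isLittleO_sq {b : ℝ} (hΔ : Tendsto (fun n : ℕ => Δ n * (n : ℝ) ^ b) atTop atTop) :
    (fun n : ℕ => (n : ℝ) ^ (-(2 * b))) =o[atTop] fun n => Δ n ^ 2 := by
  have hone : (fun _ : ℕ => (1 : ℝ)) =o[atTop] fun n : ℕ => Δ n * (n : ℝ) ^ b :=
    (isLittleO_one_left_iff ℝ).2 (tendsto_norm_atTop_atTop.comp hΔ)
  have hmul := (hone.mul_isBigO (isBigO_refl (fun n : ℕ => (n : ℝ) ^ (-b)) atTop)).pow two_pos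
  refine hmul.congr' (.of_forall fun n => ?_) ?_
  · dsimp only
    rw [one_mul, ← Real.rpow_mul_natCast (Nat.cast_nonneg n)]
    congr 1
    push_cast
    ring
  · filter_upwards [eventually_gt_atTop 0] with n hn
    rw [mul_assoc, ← Real.rpow_add (Nat.cast_pos.2 hn), add_neg_cancel, Real.rpow_zero, mul_one]

lemma eventually_bias_le (hs_pos : ∀ n, 0 < s n)
    (hs : s =Θ[atTop] fun n : ℕ => (n : ℝ) ^ (4 / (d + 4 * β)))
    (hΔ : Tendsto (fun n : ℕ => Δ n * (n : ℝ) ^ (2 * β / (d + 4 * β))) atTop atTop) (M : ℝ) :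
    ∀ᶠ n in atTop, s n ^ (-β) * (4 * M) ≤ Δ n ^ 2 / 2 := by
  have hexp : 4 / (d + 4 * β) * (-β) = -(2 * (2 * β / (d + 4 * β))) := by ring
  have hbias : (fun n => s n ^ (-β) * (4 * M)) =o[atTop] fun n => Δ n ^ 2 := by
    simp only [mul_comm _ (4 * M)]
    exact ((isTheta_rpow_mul hs_pos hs (-β)).trans_isLittleO
      (hexp ▸ rpow_isLittleO_sq hΔ)).const_mul_left (4 * M)
  filter_upwards [hbias.def one_half_pos] with n hn
  rw [Real.norm_of_nonneg (sq_nonneg (Δ n))] at hn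
  linarith [Real.le_norm_self (s n ^ (-β) * (4 * M))]

lemma sqrt_kernelMass {s : ℝ} (d : ℕ) (hs : 0 < s) :
    √(kernelMass d s) = Real.pi ^ (d / 4 : ℝ) * s ^ (-(d / 4) : ℝ) := by
  rw [kernelMass, Real.sqrt_eq_rpow, ← Real.rpow_mul (by positivity), Real.rpow_neg hs.le,
    ← div_eq_mul_inv, ← Real.div_rpow Real.pi_nonneg hs.le]
  congr 1
  ring

lemma tendsto_noiseLevel (hβ : 0 < β) (hs_pos : ∀ n, 0 < s n)
    (hs : s =Θ[atTop] fun n : ℕ => (n : ℝ) ^ (4 / (d + 4 * β)))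
    (hΔ : Tendsto (fun n : ℕ => Δ n * (n : ℝ) ^ (2 * β / (d + 4 * β))) atTop atTop) (M : ℝ) :
    Tendsto (fun n => noiseLevel d n (s n) M (Δ n ^ 2)) atTop (𝓝 0) := by
  have hexp : 4 / (d + 4 * β) * (d / 4) + -1 = -(2 * (2 * β / (d + 4 * β))) := by
    field
  have hinv : (fun n : ℕ => s n ^ (d / 4 : ℝ) * (n : ℝ) ^ (-1 : ℝ))
      =Θ[atTop] fun n : ℕ => (n : ℝ) ^ (-(2 * (2 * β / (d + 4 * β)))) := by
    refine ((isTheta_rpow_mul hs_pos hs (d / 4)).mul (isTheta_refl _ _)).trans_eventuallyEq ?_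
    filter_upwards [eventually_gt_atTop 0] with n hn
    rw [← Real.rpow_add (Nat.cast_pos.2 hn), hexp]
  refine ((hinv.trans_isLittleO (rpow_isLittleO_sq hΔ)).const_mul_left
    (√M / Real.pi ^ (d / 4 : ℝ))).tendsto_div_nhds_zero.congr fun n => ?_
  rw [noiseLevel, sqrt_kernelMass d (hs_pos n), Real.rpow_neg_one, Real.rpow_neg (hs_pos n).le]
  field

end Rates

end XssMMD

open XssMMD in
theorem mainTheorem7 {d : ℕ} (hd : 1 ≤ d) {𝒱 : Type*} [MeasurableSpace 𝒱]
    (α β M : ℝ) (hα : α ∈ Set.Ioo (0 : ℝ) 1) (hβ : 0 < β)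
    (s Δ : ℕ → ℝ) (hs_pos : ∀ n, 0 < s n)
    (hs : s =Θ[atTop] fun n : ℕ => (n : ℝ) ^ (4 / (d + 4 * β)))
    (hΔ : Tendsto (fun n : ℕ => Δ n * (n : ℝ) ^ (2 * β / (d + 4 * β))) atTop atTop)
    (h₁ h₂ : ℕ → ℕ)
    (uX uY : ∀ N : ℕ, Regressor d N 𝒱)
    (huX : ∀ N, MeasurableRegressor (gaussianKernel (s (2 * N))) (uX N))
    (huY : ∀ N, MeasurableRegressor (gaussianKernel (s (2 * N))) (uY N))
    (𝒬 : ℕ → Set (ProbabilityMeasure (Rd d × 𝒱) × ProbabilityMeasure (Rd d × 𝒱)))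
    (h𝒬 : ∀ N, ∀ q ∈ 𝒬 N,
      ((q.1 : Measure (Rd d × 𝒱)).fst, (q.2 : Measure (Rd d × 𝒱)).fst)
        ∈ smoothAlternatives d β M (Δ (2 * N)))
    (hres : ∃ C : ℝ≥0, ∀ N ≥ 1, ∀ q ∈ 𝒬 N,
      ResidualCondition (gaussianKernel (s (2 * N))) (uX N) (uY N) C
        (q.1 : Measure (Rd d × 𝒱)) (q.2 : Measure (Rd d × 𝒱))) :
    Tendsto
      (fun N : ℕ => worstCasePower (h₁ N) (h₂ N) α (gaussianKernel (s (2 * N)))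
        (uX N) (uY N) (𝒬 N))
      atTop (𝓝 1) := by
  obtain ⟨C, hC⟩ := hres
  have hdouble : Tendsto (fun N : ℕ => 2 * N) atTop atTop := tendsto_id.const_mul_atTop' two_pos
  set τ : ℕ → ℝ := fun N => noiseLevel d (2 * N) (s (2 * N)) M (Δ (2 * N) ^ 2)
  have hτ : Tendsto τ atTop (𝓝 0) := (tendsto_noiseLevel hβ hs_pos hs hΔ M).comp hdouble
  set err : ℕ → ℝ := fun N =>
    errorConst α C * ((4 * τ N + 16 * τ N ^ 2) / (Real.exp (-Real.pi ^ 2) / 2) ^ 2)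
  have herr : Tendsto err atTop (𝓝 0) := by
    simpa using ((((hτ.const_mul 4).add ((hτ.pow 2).const_mul 16)).div_const
      ((Real.exp (-Real.pi ^ 2) / 2) ^ 2)).const_mul (errorConst α C))
  have hΔpos : ∀ᶠ n in atTop, 0 < Δ n := (hΔ.eventually_gt_atTop 0).mono fun n hn =>
    pos_of_mul_pos_left hn (by positivity)
  refine tendsto_of_tendsto_of_tendsto_of_le_of_le' (g := fun N => 1 - err N)
    (by simpa using herr.const_sub 1) tendsto_const_nhds ?_
    (.of_forall fun N => worstCasePower_le_one _ _ _ _ _ _ _)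
  filter_upwards [hdouble.eventually hΔpos, hdouble.eventually (eventually_bias_le hs_pos hs hΔ M),
    eventually_ge_atTop 1] with N hδ hbias hN
  have hτN : 0 ≤ τ N := noiseLevel_nonneg _ _ _ _ (sq_nonneg _)
  have herrN : 0 ≤ err N := mul_nonneg (errorConst_nonneg α C) (by positivity)
  exact le_worstCasePower (sub_le_self 1 herrN) fun q hq =>
    one_sub_le_xssPower_of_smoothAlternatives (hs_pos _) hβ.le (Nat.one_le_iff_ne_zero.1 hN) (huX N)
      (huY N) (hC N hN q hq) hδ (h𝒬 N q hq) hbias
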